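/- Consider the sketch-based fully dynamic connectivity algorithm of Gibb et al. on a fixed set $\mathcal V$ of $V\ge 2$ vertices. The graph is initially empty, and each update inserts an absent edge or deletes a present one. The algorithm keeps levels $0,\dots,top$ with $top=O(\log V)$. On each level $i$ it keeps a spanning-forest cutset data structure $F_i$: an Euler tour tree (the tours are stored in height-balanced trees) of a forest $\mathcal F_i$ on $\mathcal V$, augmented by linear $\ell_0$-sketches over $\mathbb F_2$, each an array of $O(1)$ columns of $O(\log V)$ buckets of $O(1)$ words, summed componentwise, of the characteristic vectors of the edges leaving a component. It also keeps a dynamic tree $\mathcal T$ with path queries on $\mathcal F_{top}$, in which the weight of an edge is the lowest level on which the edge is present; here $\mathcal T$ is an Euler tour tree whose aggregates are the paths between the ends of stretches of the tours. $\mathsf{Link}(u,v)$ has no effect if $u,v$ are already connected in the forest concerned, and $\mathsf{Cut}(u,v)$ has no effect if $\{u,v\}$ is not an edge of it. An update of $e=\{u,v\}$ is processed as follows. (1) For $i=0,\dots,top$: call $F_i.\mathsf{Update}(e)$ (which adds $e$ to the sketches of $u$ and of $v$); if the update is a deletion and $e$ is an edge of $\mathcal F_i$, call $F_i.\mathsf{Cut}(u,v)$.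 (2) For $i=0,\dots,top-1$ and for $w=u$, then $w=v$: let $\mathcal C_i,\mathcal C_{i+1}$ be the components of $w$ in $\mathcal F_i$ and $\mathcal F_{i+1}$. If $F_i.\mathsf{Query}(w)$ returns an edge $\{u_{link},v_{link}\}$ and $\mathcal C_i=\mathcal C_{i+1}$ (tested by comparing the numbers of vertices), then $\mathcal C_i$ is called isolated. In this case, if $u_{link}$ and $v_{link}$ are connected in $\mathcal T$, find with a path query in $\mathcal T$ an edge $\{u_{cut},v_{cut}\}$ of maximum weight $\ell$ on the path between them and call $F_j.\mathsf{Cut}(u_{cut},v_{cut})$ for $j=\ell,\dots,top$; then call $F_j.\mathsf{Link}(u_{link},v_{link})$ for $j=i+1,\dots,top$. Every link or cut in $F_{top}$ is also done in $\mathcal T$. The update is called isolated if some isolated component is found in (2), and normal otherwise. Then, counting steps on a machine with words of $O(\log V)$ bits (following a pointer, looking up an entry of a table, evaluating a hash function and handling a word each take $O(1)$ steps), the worst-case time of every isolated update is $O(\log^4 V)$ and the worst-case time of every normal update is $O(\log^3 V)$. That is, for every $K$ there is a constant $c$ such that, whenever $top\le K\log V$ and each sketch has at most $K$ columns of at most $K\log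 V$ buckets, then for every choice of the hash functions and every valid sequence of updates, each isolated update takes at most $c\log^4 V$ steps and each normal update takes at most $c\log^3 V$ steps. -/

import Mathlib

namespace Gibb

/-! ### Counting steps -/

/-- The result of a computation together with the number of machine steps it took.
The machine is a pointer machine / word RAM with words of `O(log V)` bits; reading or following a
pointer, creating a node, comparing or combining two words each cost a constant number of steps. -/
structure Timed (α : Type) where
  val : α
  steps : ℕ

instance : Monad Timed where
  pure a := ⟨a, 0⟩
  bind x f := ⟨(f x.val).val, x.steps + (f x.val).steps⟩

/-- Spend `n` steps. -/
def tick (n : ℕ) : Timed Unit := ⟨(), n⟩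

/-! ### Balanced (AVL) trees holding sequences, augmented with aggregates -/

/-- The aggregate function by which the values of a sequence are summarized,
with the steps that one evaluation costs. -/
structure Aug (β : Type) where
  unit : β
  op : β → β → Timed β

/-- Binary trees representing (by in-order traversal) a sequence of keyed values. Every node stores
the height and the aggregate of its subtree. -/
inductive Tree (ι β : Type) : Type
  | nil : Tree ι β
  | node (height : ℕ) (agg : β) (l : Tree ι β) (key : ι) (val : β) (r : Tree ι β) : Tree ι β

namespace Tree

variable {ι β : Type}

def height : Tree ι β → ℕ
  | nil => 0
  | node h _ _ _ _ _ => h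

def agg (A : Aug β) : Tree ι β → β
  | nil => A.unit
  | node _ a _ _ _ _ => a

/-- Create (or refresh) a node, computing its height and its aggregate. -/
def mk (A : Aug β) (l : Tree ι β) (k : ι) (v : β) (r : Tree ι β) : Timed (Tree ι β) := do
  tick 1
  let a ← A.op (l.agg A) v
  let b ← A.op a (r.agg A)
  pure (node (max l.height r.height + 1) b l k v r)

/-- Create a node, doing a single or double rotation if the heights of the two sides differ
by two. -/
def bal (A : Aug β) (l : Tree ι β) (k : ι) (v : β) (r : Tree ι β) : Timed (Tree ι β) :=
  if r.height + 1 < l.height then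
    match l with
    | nil => mk A l k v r
    | node _ _ ll lk lv lr =>
      if lr.height ≤ ll.height then do
        let t ← mk A lr k v r
        mk A ll lk lv t
      else
        match lr with
        | nil => mk A l k v r
        | node _ _ m₁ mk' mv m₂ => do
          let s ← mk A ll lk lv m₁
          let t ← mk A m₂ k v r
          mk A s mk' mv t
  else if l.height + 1 < r.height then
    match r with
    | nil => mk A l k v r
    | node _ _ rl rk rv rr =>
      if rl.height ≤ rr.height then do
        let t ← mk A l k v rl
        mk A t rk rv rr
      else
        match rl with
        | nil => mk A l k v r
        | node _ _ m₁ mk' mv m₂ => do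
          let s ← mk A l k v m₁
          let t ← mk A m₂ rk rv rr
          mk A s mk' mv t
  else mk A l k v r

/-- Concatenation `l, (k, v), r` for a left side that may be higher: walk down its right spine. -/
def joinRight (A : Aug β) : Tree ι β → ι → β → Tree ι β → Timed (Tree ι β)
  | nil, k, v, r => mk A nil k v r
  | node h a ll lk lv lr, k, v, r =>
    if h ≤ r.height + 1 then mk A (node h a ll lk lv lr) k v r
    else do
      let t ← joinRight A lr k v r
      bal A ll lk lv t

/-- Concatenation `l, (k, v), r` for a right side that may be higher: walk down its left spine. -/
def joinLeft (A : Aug β) (l : Tree ι β) (k : ι) (v : β) : Tree ι β → Timed (Tree ι β)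
  | nil => mk A l k v nil
  | node h a rl rk rv rr =>
    if h ≤ l.height + 1 then mk A l k v (node h a rl rk rv rr)
    else do
      let t ← joinLeft A l k v rl
      bal A t rk rv rr

/-- The concatenation `l, (k, v), r`. -/
def join (A : Aug β) (l : Tree ι β) (k : ι) (v : β) (r : Tree ι β) : Timed (Tree ι β) :=
  if r.height < l.height then joinRight A l k v r else joinLeft A l k v r

/-- Remove the last entry of a sequence. -/
def splitLast (A : Aug β) : Tree ι β → Timed (Option (Tree ι β × ι × β))
  | nil => do
    tick 1
    pure none
  | node _ _ l k v r => do
    tick 1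
    match ← splitLast A r with
    | none => pure (some (l, k, v))
    | some (r', k', v') => do
      let t ← bal A l k v r'
      pure (some (t, k', v'))

/-- The concatenation of two sequences. -/
def append (A : Aug β) (l r : Tree ι β) : Timed (Tree ι β) := do
  match ← splitLast A l with
  | none => pure r
  | some (l', k, v) => join A l' k v r

/-- The position (left = `false`, right = `true`, read from the root) of the node with key `x`. -/
def addr [DecidableEq ι] (x : ι) : Tree ι β → Option (List Bool)
  | nil => none
  | node _ _ l k _ r =>
    if k = x then some []
    else match addr x l with
      | some p => some (false :: p)
      | none => (addr x r).map (true :: ·)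

/-- Split a sequence at the node in a given position into what precedes it, its entry, and what
follows it. -/
def splitAt (A : Aug β) : Tree ι β → List Bool → Timed (Option (Tree ι β × ι × β × Tree ι β))
  | nil, _ => do
    tick 1
    pure none
  | node _ _ l k v r, [] => do
    tick 1
    pure (some (l, k, v, r))
  | node _ _ l k v r, false :: p => do
    tick 1
    match ← splitAt A l p with
    | none => pure none
    | some (a, k', v', b) => do
      let t ← join A b k v r
      pure (some (a, k', v', t))
  | node _ _ l k v r, true :: p => do
    tick 1
    match ← splitAt A r p with
    | none => pure none
    | some (a, k', v', b) => do
      let t ← join A l k v a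
      pure (some (t, k', v', b))

/-- Change the value at the node in a given position and refresh the aggregates of the nodes
above it. -/
def modifyAt (A : Aug β) (f : β → Timed β) : Tree ι β → List Bool → Timed (Tree ι β)
  | nil, _ => do
    tick 1
    pure nil
  | node _ _ l k v r, [] => do
    let v' ← f v
    mk A l k v' r
  | node _ _ l k v r, false :: p => do
    let t ← modifyAt A f l p
    mk A t k v r
  | node _ _ l k v r, true :: p => do
    let t ← modifyAt A f r p
    mk A l k v t

end Tree

/-! ### Euler tour trees

A forest on the vertices `0, …, n - 1` is kept as the collection of the (cyclic) Euler tours of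
its trees. A tour has one entry `(v, v)` for every vertex `v`, and two entries `(u, v)`, `(v, u)`
for every edge; each tour is stored in a balanced tree. Nodes carry parent pointers, and a table
gives the node of each entry that is present. Hence looking up an entry takes one step, and finding
the root above an entry takes as many further steps as the node is deep. -/

abbrev Tour (n : ℕ) (β : Type) := Tree (Fin n × Fin n) β

/-- The collection of the roots of the tours. The list is only the set of the
roots: it is never traversed by the algorithm, which reaches a root by climbing from a node. -/
abbrev Forest (n : ℕ) (β : Type) := List (Tour n β)

namespace Forest

variable {n : ℕ} {β : Type}

/-- The tour containing an entry, and the position of the entry in it. -/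
def lookup (x : Fin n × Fin n) (F : Forest n β) : Option (Tour n β × List Bool) :=
  F.findSome? fun t => (t.addr x).map fun p => (t, p)

/-- Climb from the node of an entry (if it is present) to its root. -/
def findRoot (x : Fin n × Fin n) (F : Forest n β) : Timed (Option (Tour n β × List Bool)) :=
  match lookup x F with
  | none => ⟨none, 1⟩
  | some (t, p) => ⟨some (t, p), p.length + 1⟩

/-- All tours except the one containing the entry. -/
def remove (x : Fin n × Fin n) (F : Forest n β) : Forest n β :=
  F.filter fun t => (t.addr x).isNone

/-- Is `{u, v}` an edge of the forest? -/
def hasEdge (u v : Fin n) (F : Forest n β) : Timed Bool :=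
  ⟨(lookup (u, v) F).isSome, 1⟩

/-- `Connected(u, v)`: compare the roots found from `u` and from `v`. -/
def connected (u v : Fin n) (F : Forest n β) : Timed Bool := do
  tick 1
  let a ← findRoot (u, u) F
  let _ ← findRoot (v, v) F
  pure (match a with
    | none => false
    | some (t, _) => (t.addr (v, v)).isSome)

/-- `Link(u, v)`: if `u` and `v` are not connected, insert the edge `{u, v}`, with values `x`
and `y` for its two entries. The tours `L, (u,u), R` and `L', (v,v), R'` become
`L, (u,u), (u,v), (v,v), R', L', (v,u), R`. -/
def link (A : Aug β) (u v : Fin n) (x y : β) (F : Forest n β) : Timed (Forest n β) := do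
  let c ← connected u v F
  if c then pure F
  else
    match ← findRoot (u, u) F, ← findRoot (v, v) F with
    | some (tu, pu), some (tv, pv) =>
      match ← tu.splitAt A pu, ← tv.splitAt A pv with
      | some (l, ku, xu, r), some (l', kv, xv, r') => do
        let a ← Tree.append A r' l'
        let b ← Tree.join A .nil kv xv a
        let c ← Tree.join A b (v, u) y r
        let d ← Tree.join A .nil (u, v) x c
        let e ← Tree.join A l ku xu d
        pure (e :: remove (u, u) (remove (v, v) F))
      | _, _ => pure F
    | _, _ => pure F

/-- `Cut(u, v)`: if `{u, v}` is an edge, delete it. The tour `A, (u,v), B, (v,u), C` (or the same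
with `(u,v)` and `(v,u)` exchanged) becomes the two tours `B` and `A, C`. -/
def cut (A : Aug β) (u v : Fin n) (F : Forest n β) : Timed (Forest n β) := do
  match ← findRoot (u, v) F with
  | none => pure F
  | some (t, p) =>
    match ← t.splitAt A p with
    | none => pure F
    | some (l, _, _, r) =>
      match l.addr (v, u), r.addr (v, u) with
      | some q, _ => do
        tick (q.length + 1)
        match ← l.splitAt A q with
        | none => pure F
        | some (a, _, _, b) => do
          let c ← Tree.append A a r
          pure (b :: c :: remove (u, v) F)
      | none, some q => do
        tick (q.length + 1)
        match ← r.splitAt A q with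
        | none => pure F
        | some (b, _, _, c) => do
          let a ← Tree.append A l c
          pure (b :: a :: remove (u, v) F)
      | none, none => pure F

end Forest

/-! ### The parameters, and `ℓ₀`-sketches -/

/-- Number of bits of a machine word: `O(log V)`, and a word can hold an element of
`{0, …, V² - 1}`. -/
def wordBits (V : ℕ) : ℕ := 8 * Nat.clog 2 V

abbrev Word (V : ℕ) := BitVec (wordBits V)

/-- The parameters of the algorithm: the number `V` of vertices; the levels are `0, …, top`; a sketch
has `cols` columns of `rows` buckets each. The hash functions (the random choices of the algorithm)
are indexed by the level and the column. -/
structure Config where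
  V : ℕ
  top : ℕ
  rows : ℕ
  cols : ℕ
  sampleHash : ℕ → ℕ → Word V → Word V
  checkHash : ℕ → ℕ → Word V → Word V

variable (C : Config)

abbrev Config.Vertex := Fin C.V

/-- A sketch of a vector in `𝔽₂^(V²)`. Bucket `c * rows + r` belongs to row `r` of column `c`.
It holds the sum of the indices of the sampled nonzero coordinates and the sum of their check
values. -/
abbrev Sketch := Vector (Word C.V × Word C.V) (C.cols * C.rows)

variable {C}

/-- The coordinate of the edge `{u, v}`. -/
def edgeIndex (u v : C.Vertex) : Word C.V :=
  BitVec.ofNat _ ((min u v).val * C.V + (max u v).val)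

/-- The edge `{u, v}`, `u < v`, with a given coordinate, if there is one. -/
def decodeEdge (a : Word C.V) : Option (C.Vertex × C.Vertex) :=
  if h : a.toNat / C.V < a.toNat % C.V ∧ 0 < C.V then
    have hm : a.toNat % C.V < C.V := Nat.mod_lt _ h.2
    some (⟨a.toNat / C.V, h.1.trans hm⟩, ⟨a.toNat % C.V, hm⟩)
  else none

namespace Sketch

def zero : Timed (Sketch C) :=
  ⟨Vector.replicate _ (0, 0), 2 * (C.cols * C.rows) + 1⟩

/-- Sketches are added bucket by bucket. -/
def add (s t : Sketch C) : Timed (Sketch C) :=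
  ⟨Vector.zipWith (fun a b => (a.1 ^^^ b.1, a.2 ^^^ b.2)) s t, 2 * (C.cols * C.rows) + 1⟩

/-- Add `1` to coordinate `e`. Row `r` of a column samples the coordinates whose hash value ends in
`r` zeros. -/
def update (lev : ℕ) (e : Word C.V) (s : Sketch C) : Timed (Sketch C) :=
  ⟨Vector.ofFn fun i =>
      if (C.sampleHash lev (i.val / C.rows) e).toNat % 2 ^ (i.val % C.rows) = 0 then
        ((s.get i).1 ^^^ e, (s.get i).2 ^^^ C.checkHash lev (i.val / C.rows) e)
      else s.get i,
    4 * (C.cols * C.rows) + 1⟩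

/-- Look for a bucket whose check value shows that it has just one nonzero coordinate; the
corresponding edge is returned. -/
def query (lev : ℕ) (s : Sketch C) : Timed (Option (C.Vertex × C.Vertex)) :=
  ⟨(List.finRange (C.cols * C.rows)).findSome? fun i =>
      if (s.get i).2 = C.checkHash lev (i.val / C.rows) (s.get i).1 then decodeEdge (s.get i).1
      else none,
    4 * (C.cols * C.rows) + 1⟩

end Sketch

/-! ### The cutset data structure

An Euler tour tree in which the entry `(v, v)` holds the sketch of the characteristic vector of the
vertex `v`; so the aggregate at a root is the number of vertices of a component and the sketch of
the edges leaving the component. -/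

structure CutAgg (C : Config) where
  count : ℕ
  sketch : Sketch C

def cutAug (C : Config) : Aug (CutAgg C) where
  unit := ⟨0, Vector.replicate _ (0, 0)⟩
  op a b := do
    let s ← Sketch.add a.sketch b.sketch
    pure ⟨a.count + b.count, s⟩

abbrev Cutset (C : Config) := Forest C.V (CutAgg C)

namespace Cutset

/-- The sketch of the vertex `w` is updated by the edge with coordinate `e`. -/
def updateVertex (lev : ℕ) (e : Word C.V) (w : C.Vertex) (F : Cutset C) : Timed (Cutset C) := do
  match ← Forest.findRoot (w, w) F with
  | none => pure F
  | some (t, p) => do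
    let t' ← t.modifyAt (cutAug C) (fun a => do
      let s ← Sketch.update lev e a.sketch
      pure ⟨a.count, s⟩) p
    pure (t' :: Forest.remove (w, w) F)

/-- `Update(e)` for `e = {u, v}`. -/
def update (lev : ℕ) (u v : C.Vertex) (F : Cutset C) : Timed (Cutset C) := do
  tick 1
  let F ← updateVertex lev (edgeIndex u v) u F
  updateVertex lev (edgeIndex u v) v F

/-- `Link(u, v)`. -/
def link (u v : C.Vertex) (F : Cutset C) : Timed (Cutset C) := do
  let x ← Sketch.zero
  let y ← Sketch.zero
  Forest.link (cutAug C) u v ⟨0, x⟩ ⟨0, y⟩ F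

/-- `Cut(u, v)`. -/
def cut (u v : C.Vertex) (F : Cutset C) : Timed (Cutset C) :=
  Forest.cut (cutAug C) u v F

/-- The number of vertices of the component of `w`. -/
def componentSize (w : C.Vertex) (F : Cutset C) : Timed ℕ := do
  match ← Forest.findRoot (w, w) F with
  | none => pure 0
  | some (t, _) => pure (t.agg (cutAug C)).count

/-- `Query(w)`: an edge leaving the component of `w`, if the sketch yields one. -/
def query (lev : ℕ) (w : C.Vertex) (F : Cutset C) : Timed (Option (C.Vertex × C.Vertex)) := do
  match ← Forest.findRoot (w, w) F with
  | none => pure none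
  | some (t, _) => Sketch.query lev (t.agg (cutAug C)).sketch

end Cutset

/-! ### The dynamic tree with path queries

It maintains a forest with edge weights. It is an Euler tour tree in which the aggregate of
a stretch of a tour is the path (walk without backtracking) from the beginning to the end
of the stretch. A path is itself kept as a balanced tree, holding its successive edges and the number and
maximum weight of the edges in each subtree. -/

structure PathAgg (n : ℕ) where
  count : ℕ
  heaviest : Option (Fin n × Fin n × ℕ)

def pathAug (n : ℕ) : Aug (PathAgg n) where
  unit := ⟨0, none⟩
  op a b := ⟨⟨a.count + b.count,
    match a.heaviest, b.heaviest with
    | none, y => y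
    | x, none => x
    | some x, some y => if y.2.2 ≤ x.2.2 then some x else some y⟩, 1⟩

abbrev Path (n : ℕ) := Tree (Fin n × Fin n) (PathAgg n)

namespace Path

variable {n : ℕ}

def single (u v : Fin n) (w : ℕ) : Path n :=
  .node 1 ⟨1, some (u, v, w)⟩ .nil (u, v) ⟨1, some (u, v, w)⟩ .nil

def length (p : Path n) : ℕ := (p.agg (pathAug n)).count

/-- Entry number `i`, counting from `0`. -/
def entry : Path n → ℕ → Timed (Option (Fin n × Fin n))
  | .nil, _ => ⟨none, 1⟩
  | .node _ _ l k _ r, i => do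
    tick 1
    if i < length l then entry l i
    else if i = length l then pure (some k)
    else entry r (i - length l - 1)

/-- The first `i` entries, and the others. -/
def takeDrop : Path n → ℕ → Timed (Path n × Path n)
  | .nil, _ => ⟨(.nil, .nil), 1⟩
  | .node _ _ l k v r, i => do
    tick 1
    if i ≤ length l then do
      let (a, b) ← takeDrop l i
      let t ← Tree.join (pathAug n) b k v r
      pure (a, t)
    else do
      let (a, b) ← takeDrop r (i - length l - 1)
      let t ← Tree.join (pathAug n) l k v a
      pure (t, b)

/-- Binary search, in `fuel` rounds, for the largest `k` in `[lo, hi]` such that the last `k` edges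
of `p`, backwards, are the first `k` edges of `q` (in a forest this holds for `k`
as soon as it holds for the `k`-th of these edges). -/
def overlap (p q : Path n) : ℕ → ℕ → ℕ → Timed ℕ
  | 0, lo, _ => pure lo
  | fuel + 1, lo, hi =>
    if hi ≤ lo then ⟨lo, 1⟩
    else do
      tick 1
      let mid := (lo + hi + 1) / 2
      let a ← entry p (length p - mid)
      let b ← entry q (mid - 1)
      if a.map Prod.swap = b then overlap p q fuel mid hi
      else overlap p q fuel lo (mid - 1)

/-- Follow `p`, then `q`, and cancel the backtracking. -/
def concat (p q : Path n) : Timed (Path n) := do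
  let m := min (length p) (length q)
  let k ← overlap p q (Nat.log 2 m + 1) 0 m
  let (p₁, _) ← takeDrop p (length p - k)
  let (_, q₁) ← takeDrop q k
  Tree.append (pathAug n) p₁ q₁

end Path

def treeAug (n : ℕ) : Aug (Path n) where
  unit := .nil
  op := Path.concat

abbrev DynTree (n : ℕ) := Forest n (Path n)

namespace DynTree

variable {n : ℕ}

def connected (u v : Fin n) (T : DynTree n) : Timed Bool := Forest.connected u v T

/-- Insert the edge `{u, v}` with weight `w`. -/
def link (u v : Fin n) (w : ℕ) (T : DynTree n) : Timed (DynTree n) :=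
  Forest.link (treeAug n) u v (Path.single u v w) (Path.single v u w) T

def cut (u v : Fin n) (T : DynTree n) : Timed (DynTree n) := Forest.cut (treeAug n) u v T

/-- The heaviest edge on the path represented by a stretch of a tour. -/
def heaviest (t : Tour n (Path n)) : Option (Fin n × Fin n × ℕ) :=
  ((t.agg (treeAug n)).agg (pathAug n)).heaviest

/-- `PathQuery(u, v)`: an edge of maximum weight on the path between `u` and `v`, with its weight.
The tour is split at `(u, u)` and at `(v, v)`, and put together again. -/
def pathQuery (u v : Fin n) (T : DynTree n) :
    Timed (Option (Fin n × Fin n × ℕ) × DynTree n) := do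
  match ← Forest.findRoot (u, u) T with
  | none => pure (none, T)
  | some (t, p) =>
    match ← t.splitAt (treeAug n) p with
    | none => pure (none, T)
    | some (l, ku, xu, r) =>
      match l.addr (v, v), r.addr (v, v) with
      | some q, _ => do
        tick (q.length + 1)
        match ← l.splitAt (treeAug n) q with
        | none => pure (none, T)
        | some (l', kv, xv, m) => do
          let a ← Tree.join (treeAug n) l' kv xv m
          let t' ← Tree.join (treeAug n) a ku xu r
          pure (heaviest m, t' :: Forest.remove (u, u) T)
      | none, some q => do
        tick (q.length + 1)
        match ← r.splitAt (treeAug n) q with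
        | none => pure (none, T)
        | some (m, kv, xv, r') => do
          let a ← Tree.join (treeAug n) m kv xv r'
          let t' ← Tree.join (treeAug n) l ku xu a
          pure (heaviest m, t' :: Forest.remove (u, u) T)
      | none, none => pure (none, T)

end DynTree

/-! ### The dynamic connectivity algorithm -/

/-- One cutset data structure for each level `0, …, top`, and the dynamic tree `T`, which
holds the forest of level `top`. The weight of an edge in `T` is the lowest level whose forest contains
the edge. -/
structure State (C : Config) where
  level : Fin (C.top + 1) → Cutset C
  T : DynTree C.V

/-- The state for the graph without edges. -/
def State.init (C : Config) : State C where
  level _ := (List.finRange C.V).map fun w =>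
    .node 1 ⟨1, Vector.replicate _ (0, 0)⟩ .nil (w, w) ⟨1, Vector.replicate _ (0, 0)⟩ .nil
  T := (List.finRange C.V).map fun w => .node 1 .nil .nil (w, w) .nil .nil

/-- `Cut(u, v)` on level `j`; if `j = top`, also in `T`. -/
def cutLevel (u v : C.Vertex) (s : State C) (j : Fin (C.top + 1)) : Timed (State C) := do
  tick 1
  let F ← Cutset.cut u v (s.level j)
  let s' : State C := { s with level := Function.update s.level j F }
  if j = Fin.last C.top then do
    let T ← DynTree.cut u v s'.T
    pure { s' with T := T }
  else pure s'

/-- `Link(u, v)` on level `j`; if `j = top`, also in `T`, with weight `w`. -/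
def linkLevel (u v : C.Vertex) (w : ℕ) (s : State C) (j : Fin (C.top + 1)) :
    Timed (State C) := do
  tick 1
  let F ← Cutset.link u v (s.level j)
  let s' : State C := { s with level := Function.update s.level j F }
  if j = Fin.last C.top then do
    let T ← DynTree.link u v w s'.T
    pure { s' with T := T }
  else pure s'

/-- The levels `m, m + 1, …, top`. -/
def levelsFrom (C : Config) (m : ℕ) : List (Fin (C.top + 1)) :=
  (List.finRange (C.top + 1)).filter fun j => m ≤ j.val

/-- If `uLink` and `vLink` are connected in `T`, cut a heaviest edge on the path between them, in all
levels in which this edge occurs. -/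
def removeCycleEdge (uLink vLink : C.Vertex) (s : State C) : Timed (State C) := do
  let c ← DynTree.connected uLink vLink s.T
  if c then do
    let (e, T) ← DynTree.pathQuery uLink vLink s.T
    let s' : State C := { s with T := T }
    match e with
    | none => pure s'
    | some (uCut, vCut, lev) => (levelsFrom C lev).foldlM (cutLevel uCut vCut) s'
  else pure s

/-- Check whether the component of `w` on level `i` is isolated, and if so, link it on all
higher levels. The flag becomes `true` if the component is isolated. -/
def processVertex (i : Fin C.top) (x : State C × Bool) (w : C.Vertex) :
    Timed (State C × Bool) := do
  tick 1
  let s := x.1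
  let size ← Cutset.componentSize w (s.level i.castSucc)
  let size' ← Cutset.componentSize w (s.level i.succ)
  match ← Cutset.query i.val w (s.level i.castSucc) with
  | none => pure x
  | some (uLink, vLink) =>
    if size = size' then do
      let s ← removeCycleEdge uLink vLink s
      let s ← (levelsFrom C (i.val + 1)).foldlM (linkLevel uLink vLink (i.val + 1)) s
      pure (s, true)
    else pure x

/-- The first loop, on level `i`. -/
def updateLevel (u v : C.Vertex) (deletion : Bool) (s : State C) (i : Fin (C.top + 1)) :
    Timed (State C) := do
  tick 1
  let F ← Cutset.update i.val u v (s.level i)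
  let s' : State C := { s with level := Function.update s.level i F }
  let b ← Forest.hasEdge u v F
  if deletion && b then cutLevel u v s' i else pure s'

/-- An edge update: insertion or deletion of the edge `{u, v}`, `u ≠ v`. -/
structure EdgeUpdate (C : Config) where
  u : C.Vertex
  v : C.Vertex
  ne : u ≠ v
  deletion : Bool

/-- The update algorithm. The flag says whether an isolated component was found. -/
def process (s : State C) (x : EdgeUpdate C) : Timed (State C × Bool) := do
  let s ← (List.finRange (C.top + 1)).foldlM (updateLevel x.u x.v x.deletion) s
  (List.finRange C.top).foldlM
    (fun y i => [x.u, x.v].foldlM (processVertex i) y) (s, false)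

/-! ### Update sequences -/

/-- The edge set after an update. -/
def EdgeUpdate.apply (E : Set (Sym2 C.Vertex)) (x : EdgeUpdate C) : Set (Sym2 C.Vertex) :=
  if x.deletion then E \ {s(x.u, x.v)} else insert s(x.u, x.v) E

/-- Only present edges are deleted, and only absent edges are inserted. -/
def EdgeUpdate.Allowed (E : Set (Sym2 C.Vertex)) (x : EdgeUpdate C) : Prop :=
  if x.deletion then s(x.u, x.v) ∈ E else s(x.u, x.v) ∉ E

/-- `Reachable E s`: some valid sequence of updates, starting from the graph without edges, leads
to the edge set `E` and brings the algorithm into the state `s`. -/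
inductive Reachable : Set (Sym2 C.Vertex) → State C → Prop
  | init : Reachable ∅ (State.init C)
  | step (E : Set (Sym2 C.Vertex)) (s : State C) (x : EdgeUpdate C) :
      Reachable E s → x.Allowed E → Reachable (x.apply E) (process s x).val.1

/-- The update is isolated: while processing it the algorithm finds an isolated component. -/
def IsIsolated (s : State C) (x : EdgeUpdate C) : Prop := (process s x).val.2 = true

/-- The update is normal: no isolated component occurs. -/
def IsNormal (s : State C) (x : EdgeUpdate C) : Prop := ¬ IsIsolated s x

/-- The number of steps for an update. -/
def updateTime (s : State C) (x : EdgeUpdate C) : ℕ := (process s x).steps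

end Gibb

/-!
The cost of an update is found by adding up the costs of the operations on balanced trees; the proof
has to supply bounds on the sizes of these trees, and to make sure that no logarithm is wasted.

*Sizes.* It is not necessary to know that the tours are Euler tours, or that the paths are paths in a
forest. The total length of the tours plus twice their number (`Forest.weight`) is `3 * V` initially. A
link removes two tours from the collection and adds one that is longer by two; a cut removes a tour and
adds two whose total length is smaller by two. So the weight never exceeds `3 * V`, and each tour is
kept in a tree of height `O(log V)`. The path stored for a stretch of a tour has at most as many edges
as the stretch has entries (`treeAug_measured`), so that its tree has height `O(log V)`, too.

*Operations on a tour.* Splitting a balanced tree joins two trees at each level of the way back to the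
root, but the costs of these joins telescope (`Tree.splitAt_spec_telescoping`). Hence links, cuts and
path queries create just `O(log V)` nodes. A node costs `O(log V)` in a cutset data structure (a sketch
has `O(log V)` words) and `O(log² V)` in the dynamic tree (`Path.concat_spec`: a binary search among
entries of balanced trees). So a link or cut costs `O(log² V)` on one level and `O(log³ V)` in the
dynamic tree.

*Updates.* Links and cuts in the dynamic tree accompany those on the top level only; so a pass through
all levels includes one of them, and costs `O(log³ V)` (`sum_levelCost_le`). A normal update makes one
such pass, followed by `O(log V)` queries that cost `O(log V)` each. In an isolated update each of the
`O(log V)` isolated components costs a path query and two more passes, which gives `O(log⁴ V)`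
(`process_spec`).
-/

namespace Gibb

open Timed

/-! ### Cost specifications -/

/-- The computation `m` takes at most `n` steps and its result satisfies `Q`. -/
def Timed.Spec {α : Type} (m : Timed α) (n : ℕ) (Q : α → Prop) : Prop :=
  m.steps ≤ n ∧ Q m.val

namespace Timed.Spec

variable {α γ : Type} {Q Q' : α → Prop} {R : γ → Prop} {n n' : ℕ}

theorem mono {m : Timed α} (h : m.Spec n Q) (hn : n ≤ n') (hQ : ∀ a, Q a → Q' a) :
    m.Spec n' Q' :=
  ⟨h.1.trans hn, hQ _ h.2⟩

theorem weaken {m : Timed α} (h : m.Spec n Q) (hn : n ≤ n') : m.Spec n' Q :=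
  h.mono hn fun _ => id

theorem pure {a : α} (h : Q a) : (Pure.pure a : Timed α).Spec n Q := ⟨Nat.zero_le _, h⟩

theorem bind {m : Timed α} {f : α → Timed γ} (h : m.Spec n Q)
    (hf : ∀ a, Q a → (f a).Spec n' R) : (m >>= f).Spec (n + n') R :=
  ⟨Nat.add_le_add h.1 (hf _ h.2).1, (hf _ h.2).2⟩

/-- The bind rule for a given budget. -/
theorem bind_of_le {m : Timed α} {f : α → Timed γ} (h : m.Spec n Q) (hn : n ≤ n')
    (hf : ∀ a, Q a → (f a).Spec (n' - n) R) : (m >>= f).Spec n' R :=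
  (h.bind hf).weaken (by omega)

theorem tick_bind {f : Unit → Timed γ} (hf : (f ()).Spec n' R) :
    (tick n >>= f).Spec (n + n') R :=
  ⟨Nat.add_le_add_left hf.1 n, hf.2⟩

/-- A loop that keeps the invariant `I` costs at most the sum of the costs of its rounds. -/
theorem foldlM {f : γ → α → Timed γ} {I : γ → Prop} {cost : α → ℕ}
    (h : ∀ s a, I s → (f s a).Spec (cost a) I) (l : List α) (s : γ) (hs : I s) :
    (l.foldlM f s).Spec (l.map cost).sum I := by
  induction l generalizing s with
  | nil => exact Spec.pure hs
  | cons a l ih =>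
    rw [List.foldlM_cons, List.map_cons, List.sum_cons]
    exact (h s a hs).bind fun s' hs' => ih s' hs'

end Timed.Spec

/-- Specification of a computation that passes on a flag: in any case it takes at most `big` steps
and its result satisfies `I`; if the flag is not set in the end, then it was not set at the beginning
(where its value is `flag`) and the computation took at most `small` steps. -/
def Timed.FlagSpec {σ : Type} (m : Timed (σ × Bool)) (flag : Bool) (big small : ℕ)
    (I : σ → Prop) : Prop :=
  m.Spec big (fun y => I y.1) ∧ (m.val.2 = false → flag = false ∧ m.steps ≤ small)

namespace Timed.FlagSpec

variable {σ α : Type} {I : σ → Prop} {Q : α → Prop} {n big small : ℕ} {flag : Bool}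

theorem pure {y : σ × Bool} (h : I y.1) : (Pure.pure y : Timed _).FlagSpec y.2 big small I :=
  ⟨Spec.pure h, fun hy => ⟨hy, Nat.zero_le _⟩⟩

theorem bind {m : Timed α} {f : α → Timed (σ × Bool)} (h : m.Spec n Q)
    (hf : ∀ a, Q a → (f a).FlagSpec flag big small I) :
    (m >>= f).FlagSpec flag (n + big) (n + small) I :=
  ⟨h.bind fun a ha => (hf a ha).1, fun hy =>
    ⟨((hf _ h.2).2 hy).1, Nat.add_le_add h.1 ((hf _ h.2).2 hy).2⟩⟩

theorem of_flag_set {m : Timed (σ × Bool)} (h : m.Spec big fun y => I y.1 ∧ y.2 = true) :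
    m.FlagSpec flag big small I :=
  ⟨h.mono le_rfl fun _ => And.left, fun hy => by simp [h.2.2] at hy⟩

theorem weaken {m : Timed (σ × Bool)} (h : m.FlagSpec flag big small I) {big' small' : ℕ}
    (hb : big ≤ big') (hs : small ≤ small') : m.FlagSpec flag big' small' I :=
  ⟨h.1.weaken hb, fun hy => ⟨(h.2 hy).1, (h.2 hy).2.trans hs⟩⟩

theorem foldlM {f : σ × Bool → α → Timed (σ × Bool)}
    (h : ∀ y a, I y.1 → (f y a).FlagSpec y.2 big small I) (l : List α) (y : σ × Bool)
    (hy : I y.1) : (l.foldlM f y).FlagSpec y.2 (l.length * big) (l.length * small) I := by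
  induction l generalizing y with
  | nil => exact pure hy
  | cons a l ih =>
    obtain ⟨h1, h2⟩ := h y a hy
    obtain ⟨ih1, ih2⟩ := ih (f y a).val h1.2
    rw [List.foldlM_cons, List.length_cons, add_one_mul, add_one_mul]
    refine ⟨⟨(Nat.add_le_add h1.1 ih1.1).trans (add_comm _ _).le, ih1.2⟩, fun h' => ?_⟩
    obtain ⟨e1, e2⟩ := ih2 h'
    exact ⟨(h2 e1).1, (Nat.add_le_add (h2 e1).2 e2).trans (add_comm _ _).le⟩

end Timed.FlagSpec

/-! ### Balanced trees -/

/-- The values are measured by `P`, where `P m b` says that `b` is a proper value of measure `m`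
(or at most `m`), in such a way that measures add up under the aggregate function. As long as the
measures stay within `N`, computing the aggregate of a new node (two evaluations, and one step for
the node) takes at most `d` steps. -/
structure Aug.Measured {β : Type} (A : Aug β) (P : ℕ → β → Prop) (N d : ℕ) : Prop where
  unit : P 0 A.unit
  op {m m' : ℕ} {a b : β} : P m a → P m' b → m + m' ≤ N →
    2 * (A.op a b).steps + 1 ≤ d ∧ P (m + m') (A.op a b).val

namespace Tree

variable {ι β : Type} {A : Aug β} {P : ℕ → β → Prop} {N d : ℕ}

/-- The length of the sequence held by a tree. -/
def size : Tree ι β → ℕ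
  | nil => 0
  | node _ _ l _ _ r => l.size + 1 + r.size

@[simp] theorem height_nil : (nil : Tree ι β).height = 0 := rfl

@[simp] theorem height_node (h : ℕ) (a : β) (l : Tree ι β) (k : ι) (v : β) (r : Tree ι β) :
    (node h a l k v r).height = h := rfl

@[simp] theorem size_nil : (nil : Tree ι β).size = 0 := rfl

@[simp] theorem size_node (h : ℕ) (a : β) (l : Tree ι β) (k : ι) (v : β) (r : Tree ι β) :
    (node h a l k v r).size = l.size + 1 + r.size := rfl

/-- The AVL invariant: stored heights are correct and the heights of siblings differ by at most
one. Moreover every value has measure `1`, and every stored aggregate has the size of its subtree as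
measure. -/
def Good (P : ℕ → β → Prop) : Tree ι β → Prop
  | nil => True
  | node h a l _ v r => l.Good P ∧ r.Good P ∧ h = max l.height r.height + 1 ∧
      l.height ≤ r.height + 1 ∧ r.height ≤ l.height + 1 ∧ P (l.size + 1 + r.size) a ∧ P 1 v

theorem Good.agg (hA : A.Measured P N d) {t : Tree ι β} (ht : t.Good P) :
    P t.size (t.agg A) := by
  cases t with
  | nil => exact hA.unit
  | node h a l k v r => exact ht.2.2.2.2.2.1

theorem Good.two_pow_height_le {t : Tree ι β} (ht : t.Good P) :
    2 ^ t.height ≤ (t.size + 1) ^ 2 := by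
  induction t with
  | nil => simp
  | node h a l k v r ihl ihr =>
    obtain ⟨hl, hr, rfl, h1, h2, -, -⟩ := ht
    have hl' := ihl hl
    have hr' := ihr hr
    simp only [height_node, size_node]
    have e : (l.size + 1 + r.size + 1) = (l.size + 1) + (r.size + 1) := by ring
    rw [e]
    generalize l.size + 1 = x at *
    generalize r.size + 1 = y at *
    have e1 : 2 ^ l.height ≤ 2 * 2 ^ r.height := by
      rw [← pow_succ']; exact Nat.pow_le_pow_right (by norm_num) h1
    have e2 : 2 ^ r.height ≤ 2 * 2 ^ l.height := by
      rw [← pow_succ']; exact Nat.pow_le_pow_right (by norm_num) h2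
    rw [pow_succ']
    rcases le_total l.height r.height with h | h
    · rw [max_eq_right h]
      rcases le_total x y with h' | h' <;> nlinarith
    · rw [max_eq_left h]
      rcases le_total x y with h' | h' <;> nlinarith

theorem Good.height_le {t : Tree ι β} (ht : t.Good P) {b : ℕ} (hb : t.size + 1 ≤ 2 ^ b) :
    t.height ≤ 2 * b := by
  have h : 2 ^ t.height ≤ 2 ^ (2 * b) := by
    rw [mul_comm 2 b, pow_mul]
    exact ht.two_pow_height_le.trans (Nat.pow_le_pow_left hb 2)
  exact (Nat.pow_le_pow_iff_right (by norm_num)).1 h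

theorem mk_spec (hA : A.Measured P N d) {l r : Tree ι β} {k : ι} {v : β} (hl : l.Good P)
    (hr : r.Good P) (hv : P 1 v) (h1 : l.height ≤ r.height + 1) (h2 : r.height ≤ l.height + 1)
    (hN : l.size + 1 + r.size ≤ N) :
    (mk A l k v r).Spec d fun t =>
      t.Good P ∧ t.size = l.size + 1 + r.size ∧ t.height = max l.height r.height + 1 := by
  obtain ⟨s1, p1⟩ := hA.op (hl.agg hA) hv (by omega)
  obtain ⟨s2, p2⟩ := hA.op p1 (hr.agg hA) hN
  refine ⟨?_, ⟨hl, hr, rfl, h1, h2, p2, hv⟩, rfl, rfl⟩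
  change 1 + ((A.op _ _).steps + ((A.op _ _).steps + 0)) ≤ d
  omega

theorem bal_spec (hA : A.Measured P N d) {l r : Tree ι β} {k : ι} {v : β} (hl : l.Good P)
    (hr : r.Good P) (hv : P 1 v) (h1 : l.height ≤ r.height + 2) (h2 : r.height ≤ l.height + 2)
    (hN : l.size + 1 + r.size ≤ N) :
    (bal A l k v r).Spec (3 * d) fun t =>
      t.Good P ∧ t.size = l.size + 1 + r.size ∧ max l.height r.height ≤ t.height ∧
      t.height ≤ max l.height r.height + 1 ∧
      (l.height ≤ r.height + 1 → r.height ≤ l.height + 1 →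
        t.height = max l.height r.height + 1) := by
  unfold bal
  split_ifs with c1 c2
  · cases l with
    | nil => simp at c1
    | node h a ll lk lv lr =>
      obtain ⟨gl, gr, rfl, b1, b2, -, gv⟩ := hl
      simp only [height_node, size_node] at *
      split_ifs with c3
      · refine (mk_spec hA gr hr hv (by omega) (by omega) (by omega)).bind_of_le (by omega)
          fun t ⟨gt, st, et⟩ => ?_
        refine (mk_spec hA gl gt gv (by omega) (by omega) (by omega)).mono (by omega)
          fun t' ⟨gt', st', et'⟩ => ⟨gt', ?_⟩
        omega
      · cases lr with
        | nil => simp at c3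
        | node h a m₁ mk mv m₂ =>
          obtain ⟨g₁, g₂, rfl, d1, d2, -, gm⟩ := gr
          simp only [height_node, size_node] at *
          refine (mk_spec hA gl g₁ gv (by omega) (by omega) (by omega)).bind_of_le (by omega)
            fun s ⟨gs, ss, es⟩ => ?_
          refine (mk_spec hA g₂ hr hv (by omega) (by omega) (by omega)).bind_of_le (by omega)
            fun t ⟨gt, st, et⟩ => ?_
          refine (mk_spec hA gs gt gm (by omega) (by omega) (by omega)).mono (by omega)
            fun t' ⟨gt', st', et'⟩ => ⟨gt', ?_⟩
          omega
  · cases r with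
    | nil => simp at c2
    | node h a rl rk rv rr =>
      obtain ⟨gl, gr, rfl, b1, b2, -, gv⟩ := hr
      simp only [height_node, size_node] at *
      split_ifs with c3
      · refine (mk_spec hA hl gl hv (by omega) (by omega) (by omega)).bind_of_le (by omega)
          fun t ⟨gt, st, et⟩ => ?_
        refine (mk_spec hA gt gr gv (by omega) (by omega) (by omega)).mono (by omega)
          fun t' ⟨gt', st', et'⟩ => ⟨gt', ?_⟩
        omega
      · cases rl with
        | nil => simp at c3
        | node h a m₁ mk mv m₂ =>
          obtain ⟨g₁, g₂, rfl, d1, d2, -, gm⟩ := gl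
          simp only [height_node, size_node] at *
          refine (mk_spec hA hl g₁ hv (by omega) (by omega) (by omega)).bind_of_le (by omega)
            fun s ⟨gs, ss, es⟩ => ?_
          refine (mk_spec hA g₂ gr gv (by omega) (by omega) (by omega)).bind_of_le (by omega)
            fun t ⟨gt, st, et⟩ => ?_
          refine (mk_spec hA gs gt gm (by omega) (by omega) (by omega)).mono (by omega)
            fun t' ⟨gt', st', et'⟩ => ⟨gt', ?_⟩
          omega
  · exact (mk_spec hA hl hr hv (by omega) (by omega) hN).mono (by omega) fun t ht =>
      ⟨ht.1, ht.2.1, by omega, by omega, fun _ _ => ht.2.2⟩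

theorem joinRight_spec (hA : A.Measured P N d) {l r : Tree ι β} {k : ι} {v : β} (hl : l.Good P)
    (hr : r.Good P) (hv : P 1 v) (h : r.height ≤ l.height) (hN : l.size + 1 + r.size ≤ N) :
    (joinRight A l k v r).Spec (d + 3 * d * (l.height - r.height)) fun t =>
      t.Good P ∧ t.size = l.size + 1 + r.size ∧ l.height ≤ t.height ∧
      t.height ≤ l.height + 1 := by
  induction l with
  | nil =>
    refine (mk_spec (l := nil) hA trivial hr hv (by simp) (by omega) hN).mono (by omega)
      fun t ⟨gt, st, et⟩ => ⟨gt, st, by omega, ?_⟩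
    simp only [height_nil] at *
    omega
  | node h a ll lk lv lr _ ih =>
    rw [joinRight]
    split_ifs with c
    · simp only [height_node] at *
      exact (mk_spec hA hl hr hv c (by simp only [height_node]; omega) hN).mono (by omega)
        fun t ⟨gt, st, et⟩ => ⟨gt, st, by simp at et; omega, by simp at et; omega⟩
    · obtain ⟨gl, gr, rfl, b1, b2, -, gv⟩ := hl
      simp only [height_node, size_node] at *
      have key : d + 3 * d * (lr.height - r.height) + 3 * d ≤
          d + 3 * d * (max ll.height lr.height + 1 - r.height) := by
        obtain ⟨x, hx⟩ : ∃ x, x = lr.height - r.height := ⟨_, rfl⟩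
        obtain ⟨y, hy⟩ : ∃ y, max ll.height lr.height + 1 - r.height = x + 1 + y :=
          ⟨max ll.height lr.height + 1 - r.height - (x + 1), by omega⟩
        rw [← hx, hy]
        nlinarith
      refine (ih gr (by omega) (by omega)).bind_of_le (by omega)
        fun t ⟨gt, st, et1, et2⟩ => ?_
      refine (bal_spec hA gl gt gv (by omega) (by omega) (by omega)).mono (by omega)
        fun t' ⟨gt', st', f1, f2, f3⟩ => ⟨gt', ?_⟩
      omega

theorem joinLeft_spec (hA : A.Measured P N d) {l r : Tree ι β} {k : ι} {v : β} (hl : l.Good P)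
    (hr : r.Good P) (hv : P 1 v) (h : l.height ≤ r.height) (hN : l.size + 1 + r.size ≤ N) :
    (joinLeft A l k v r).Spec (d + 3 * d * (r.height - l.height)) fun t =>
      t.Good P ∧ t.size = l.size + 1 + r.size ∧ r.height ≤ t.height ∧
      t.height ≤ r.height + 1 := by
  induction r with
  | nil =>
    refine (mk_spec (r := nil) hA hl trivial hv (by omega) (by simp) hN).mono (by omega)
      fun t ⟨gt, st, et⟩ => ⟨gt, st, by omega, ?_⟩
    simp only [height_nil] at *
    omega
  | node h a rl rk rv rr ih _ =>
    rw [joinLeft]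
    split_ifs with c
    · simp only [height_node] at *
      exact (mk_spec hA hl hr hv (by simp only [height_node]; omega) c hN).mono (by omega)
        fun t ⟨gt, st, et⟩ => ⟨gt, st, by simp at et; omega, by simp at et; omega⟩
    · obtain ⟨gl, gr, rfl, b1, b2, -, gv⟩ := hr
      simp only [height_node, size_node] at *
      have key : d + 3 * d * (rl.height - l.height) + 3 * d ≤
          d + 3 * d * (max rl.height rr.height + 1 - l.height) := by
        obtain ⟨x, hx⟩ : ∃ x, x = rl.height - l.height := ⟨_, rfl⟩
        obtain ⟨y, hy⟩ : ∃ y, max rl.height rr.height + 1 - l.height = x + 1 + y :=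
          ⟨max rl.height rr.height + 1 - l.height - (x + 1), by omega⟩
        rw [← hx, hy]
        nlinarith
      refine (ih gl (by omega) (by omega)).bind_of_le (by omega)
        fun t ⟨gt, st, et1, et2⟩ => ?_
      refine (bal_spec hA gt gr gv (by omega) (by omega) (by omega)).mono (by omega)
        fun t' ⟨gt', st', f1, f2, f3⟩ => ⟨gt', ?_⟩
      omega

/-- Joining costs as much as the difference of the heights: only the part of the spine of the
higher tree above the height of the lower one is visited. -/
theorem join_spec (hA : A.Measured P N d) {l r : Tree ι β} {k : ι} {v : β} (hl : l.Good P)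
    (hr : r.Good P) (hv : P 1 v) (hN : l.size + 1 + r.size ≤ N) :
    (join A l k v r).Spec (d + 3 * d * (max l.height r.height - min l.height r.height)) fun t =>
      t.Good P ∧ t.size = l.size + 1 + r.size ∧ max l.height r.height ≤ t.height ∧
      t.height ≤ max l.height r.height + 1 := by
  unfold join
  split_ifs with c
  · rw [max_eq_left c.le, min_eq_right c.le]
    exact joinRight_spec hA hl hr hv c.le hN
  · rw [not_lt] at c
    rw [max_eq_right c, min_eq_left c]
    exact joinLeft_spec hA hl hr hv c hN

/-- Joining with a bound on the cost in terms of a bound on both heights. -/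
theorem join_spec_of_height_le (hA : A.Measured P N d) {l r : Tree ι β} {k : ι} {v : β}
    (hl : l.Good P) (hr : r.Good P) (hv : P 1 v) (hN : l.size + 1 + r.size ≤ N) {H : ℕ}
    (h1 : l.height ≤ H) (h2 : r.height ≤ H) :
    (join A l k v r).Spec (d + 3 * d * H) fun t =>
      t.Good P ∧ t.size = l.size + 1 + r.size ∧ max l.height r.height ≤ t.height ∧
      t.height ≤ max l.height r.height + 1 :=
  (join_spec hA hl hr hv hN).weaken
    (Nat.add_le_add_left (Nat.mul_le_mul_left _ (by omega)) _)

theorem splitLast_spec (hA : A.Measured P N d) {t : Tree ι β} (ht : t.Good P)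
    (hN : t.size ≤ N) :
    (splitLast A t).Spec (1 + (1 + 3 * d) * t.height) fun o =>
      match o with
      | none => t.size = 0
      | some (t', _, v) => t'.Good P ∧ P 1 v ∧ t'.size + 1 = t.size ∧
        t'.height ≤ t.height ∧ t.height ≤ t'.height + 1 := by
  induction t with
  | nil => exact Spec.tick_bind (n' := 0) (Spec.pure rfl)
  | node h a l k v r _ ih =>
    obtain ⟨gl, gr, rfl, b1, b2, -, gv⟩ := ht
    simp only [height_node, size_node] at *
    rw [splitLast]
    have key : 1 + (1 + (1 + 3 * d) * r.height + 3 * d) ≤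
        1 + (1 + 3 * d) * (max l.height r.height + 1) := by
      have := Nat.mul_le_mul_left (1 + 3 * d) (le_max_right l.height r.height)
      rw [mul_add_one]
      omega
    refine Spec.weaken (Spec.tick_bind ((ih gr (by omega)).bind (n' := 3 * d) fun o ho => ?_)) key
    match o with
    | none =>
      have := gr.height_le (b := 0) (by simpa using ho)
      exact Spec.pure ⟨gl, gv, by omega, by omega, by omega⟩
    | some (r', k', v') =>
      obtain ⟨g', p', s', e1, e2⟩ := ho
      refine (bal_spec hA gl g' gv (by omega) (by omega) (by omega)).bind_of_le le_rfl
        fun t ⟨gt, st, f1, f2, f3⟩ => Spec.pure ⟨gt, p', ?_⟩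
      omega

theorem append_spec (hA : A.Measured P N d) {l r : Tree ι β} (hl : l.Good P)
    (hr : r.Good P) (hN : l.size + r.size ≤ N) {H : ℕ} (h1 : l.height ≤ H) (h2 : r.height ≤ H) :
    (append A l r).Spec (1 + d + (1 + 6 * d) * H) fun t =>
      t.Good P ∧ t.size = l.size + r.size := by
  unfold append
  have key : 1 + (1 + 3 * d) * l.height + (d + 3 * d * H) ≤ 1 + d + (1 + 6 * d) * H := by
    have := Nat.mul_le_mul_left (1 + 3 * d) h1
    linarith
  refine ((splitLast_spec hA hl (by omega)).bind (n' := d + 3 * d * H) fun o ho => ?_).weaken key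
  match o with
  | none => exact Spec.pure ⟨hr, by simp only at ho; omega⟩
  | some (l', k, v) =>
    obtain ⟨g, p, s, e1, e2⟩ := ho
    exact (join_spec_of_height_le hA g hr p (by omega) (by omega) h2).mono le_rfl
      fun t ht => ⟨ht.1, by omega⟩

/-- Although every step of the way back joins two trees, splitting takes only a constant number of
steps per level: the cost of a join is the growth of the height of the part that is extended, up to a
constant, so the costs telescope. The heights of the two parts in the bound are this potential. -/
theorem splitAt_spec_telescoping (hA : A.Measured P N d) {t : Tree ι β} (ht : t.Good P)
    (hN : t.size ≤ N) (p : List Bool) :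
    (splitAt A t p).val.elim ((splitAt A t p).steps ≤ 1 + t.height) fun (a, _, v, b) =>
      (splitAt A t p).steps ≤ 1 + (1 + 4 * d) * t.height + 3 * d * (a.height + b.height) ∧
      a.Good P ∧ b.Good P ∧ P 1 v ∧ a.size + 1 + b.size = t.size ∧
      a.height ≤ t.height ∧ b.height ≤ t.height := by
  induction t generalizing p with
  | nil => exact le_rfl
  | node h a l k v r ihl ihr =>
    obtain ⟨gl, gr, rfl, b1, b2, -, gv⟩ := ht
    simp only [height_node, size_node] at *
    match p with
    | [] =>
      exact ⟨show 1 + 0 ≤ _ by omega, gl, gr, gv, rfl, Nat.le_succ_of_le (le_max_left _ _),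
        Nat.le_succ_of_le (le_max_right _ _)⟩
    | false :: p =>
      have ih := ihl gl (by omega) p
      rw [splitAt]
      generalize splitAt A l p = x at ih ⊢
      obtain ⟨_ | ⟨a, k', v', b⟩, n⟩ := x
      · simp only [Option.elim] at ih
        change 1 + (n + 0) ≤ _
        omega
      · simp only [Option.elim] at ih
        obtain ⟨hn, ga, gb, pv, hs, ha, hb⟩ := ih
        have J := join_spec hA gb gr (k := k) gv (by omega)
        change 1 + (n + ((join A b k v r).steps + 0)) ≤
            1 + (1 + 4 * d) * (max l.height r.height + 1) +
              3 * d * (a.height + (join A b k v r).val.height) ∧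
          a.Good P ∧ (join A b k v r).val.Good P ∧ P 1 v' ∧
          a.size + 1 + (join A b k v r).val.size = l.size + 1 + r.size ∧
          a.height ≤ max l.height r.height + 1 ∧
          (join A b k v r).val.height ≤ max l.height r.height + 1
        generalize join A b k v r = y at J ⊢
        obtain ⟨t, m⟩ := y
        obtain ⟨c, gt, st, f1, f2⟩ := J
        dsimp only at *
        refine ⟨?_, ga, gt, pv, by omega, by omega, by omega⟩
        have e1 := Nat.mul_le_mul_left (3 * d)
          (show max b.height r.height - min b.height r.height + b.height ≤ t.height + 1 by omega)
        have e2 := Nat.mul_le_mul_left (1 + 4 * d) (le_max_left l.height r.height)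
        linarith
    | true :: p =>
      have ih := ihr gr (by omega) p
      rw [splitAt]
      generalize splitAt A r p = x at ih ⊢
      obtain ⟨_ | ⟨a, k', v', b⟩, n⟩ := x
      · simp only [Option.elim] at ih
        change 1 + (n + 0) ≤ _
        omega
      · simp only [Option.elim] at ih
        obtain ⟨hn, ga, gb, pv, hs, ha, hb⟩ := ih
        have J := join_spec hA gl ga (k := k) gv (by omega)
        change 1 + (n + ((join A l k v a).steps + 0)) ≤
            1 + (1 + 4 * d) * (max l.height r.height + 1) +
              3 * d * ((join A l k v a).val.height + b.height) ∧
          (join A l k v a).val.Good P ∧ b.Good P ∧ P 1 v' ∧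
          (join A l k v a).val.size + 1 + b.size = l.size + 1 + r.size ∧
          (join A l k v a).val.height ≤ max l.height r.height + 1 ∧
          b.height ≤ max l.height r.height + 1
        generalize join A l k v a = y at J ⊢
        obtain ⟨t, m⟩ := y
        obtain ⟨c, gt, st, f1, f2⟩ := J
        dsimp only at *
        refine ⟨?_, gt, gb, pv, by omega, by omega, by omega⟩
        have e1 := Nat.mul_le_mul_left (3 * d)
          (show max l.height a.height - min l.height a.height + a.height ≤ t.height + 1 by omega)
        have e2 := Nat.mul_le_mul_left (1 + 4 * d) (le_max_right l.height r.height)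
        linarith

theorem splitAt_spec (hA : A.Measured P N d) {t : Tree ι β} (ht : t.Good P)
    (hN : t.size ≤ N) (p : List Bool) {H : ℕ} (hH : t.height ≤ H) :
    (splitAt A t p).Spec (1 + (1 + 10 * d) * H) fun o =>
      ∀ a k v b, o = some (a, k, v, b) →
        a.Good P ∧ b.Good P ∧ P 1 v ∧ a.size + 1 + b.size = t.size ∧
        a.height ≤ H ∧ b.height ≤ H := by
  have h := splitAt_spec_telescoping hA ht hN p
  unfold Spec
  generalize splitAt A t p = x at h ⊢
  obtain ⟨_ | ⟨a, k, v, b⟩, n⟩ := x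
  · simp only [Option.elim] at h
    exact ⟨by simp only; nlinarith, by simp⟩
  · obtain ⟨hn, ga, gb, pv, hs, ha, hb⟩ := h
    refine ⟨?_, ?_⟩
    · have e1 := Nat.mul_le_mul_left (3 * d)
        (show a.height + b.height ≤ H + H by omega)
      have e2 := Nat.mul_le_mul_left (1 + 4 * d) hH
      simp only at hn ⊢
      linarith
    · rintro _ _ _ _ ⟨⟩
      exact ⟨ga, gb, pv, hs, ha.trans hH, hb.trans hH⟩

theorem length_addr_lt [DecidableEq ι] {x : ι} {t : Tree ι β} (ht : t.Good P) {p : List Bool}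
    (hp : t.addr x = some p) : p.length < t.height := by
  induction t generalizing p with
  | nil => simp [addr] at hp
  | node h a l k v r ihl ihr =>
    obtain ⟨gl, gr, rfl, -⟩ := ht
    rw [addr] at hp
    rw [height_node]
    split_ifs at hp
    · simp only [Option.some.injEq] at hp
      simp [← hp]
    · cases hq : addr x l with
      | some q =>
        have := ihl gl hq
        simp only [hq, Option.some.injEq] at hp
        simp only [← hp, List.length_cons]
        omega
      | none =>
        simp only [hq, Option.map_eq_some_iff] at hp
        obtain ⟨q, hq', rfl⟩ := hp
        have := ihr gr hq'
        simp only [List.length_cons]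
        omega

theorem modifyAt_spec (hA : A.Measured P N d) {f : β → Timed β} {n : ℕ}
    (hf : ∀ v, P 1 v → (f v).Spec n (P 1)) {t : Tree ι β} (ht : t.Good P) (hN : t.size ≤ N)
    (p : List Bool) :
    (modifyAt A f t p).Spec (1 + n + d * t.height) fun t' =>
      t'.Good P ∧ t'.size = t.size ∧ t'.height = t.height := by
  induction t generalizing p with
  | nil => exact Spec.tick_bind (n' := n) (Spec.pure ⟨trivial, rfl, rfl⟩)
  | node h a l k v r ihl ihr =>
    obtain ⟨gl, gr, rfl, b1, b2, -, gv⟩ := ht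
    simp only [height_node, size_node] at *
    rw [mul_add_one]
    have e1 := Nat.mul_le_mul_left d (le_max_left l.height r.height)
    have e2 := Nat.mul_le_mul_left d (le_max_right l.height r.height)
    match p with
    | [] =>
      exact ((hf v gv).bind fun v' hv' => mk_spec hA gl gr hv' b1 b2 hN).weaken (by omega)
    | false :: p =>
      refine ((ihl gl (by omega) p).bind (n' := d) fun t ⟨gt, st, et⟩ => ?_).weaken (by omega)
      exact (mk_spec hA gt gr gv (by omega) (by omega) (by omega)).mono le_rfl
        fun t' ⟨gt', st', et'⟩ => ⟨gt', by omega, by omega⟩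
    | true :: p =>
      refine ((ihr gr (by omega) p).bind (n' := d) fun t ⟨gt, st, et⟩ => ?_).weaken (by omega)
      exact (mk_spec hA gl gt gv (by omega) (by omega) (by omega)).mono le_rfl
        fun t' ⟨gt', st', et'⟩ => ⟨gt', by omega, by omega⟩

end Tree

/-! ### Euler tour forests -/

namespace Forest

variable {n : ℕ} {β : Type} {A : Aug β} {P : ℕ → β → Prop} {N d b : ℕ} {F : Forest n β}

/-- The total length of the tours, where each tour counts two more. Linking adds two entries and
merges two tours into one; cutting removes two entries and divides a tour. So neither of them
increases this number. -/
def weight (F : Forest n β) : ℕ := (F.map fun t => t.size + 2).sum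

/-- All tours are kept in proper balanced trees, and the weight of the forest is at most `N`. -/
def Good (P : ℕ → β → Prop) (N : ℕ) (F : Forest n β) : Prop :=
  (∀ t ∈ F, t.Good P) ∧ F.weight ≤ N

theorem weight_cons (t : Tour n β) (F : Forest n β) :
    weight (t :: F) = t.size + 2 + weight F := rfl

theorem mem_of_mem_remove {x : Fin n × Fin n} {t : Tour n β} (h : t ∈ remove x F) : t ∈ F :=
  List.mem_of_mem_filter h

theorem mem_remove {x : Fin n × Fin n} {t : Tour n β} (h : t ∈ F) (ht : t.addr x = none) :
    t ∈ remove x F := by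
  simp [remove, h, ht]

theorem weight_remove_le (x : Fin n × Fin n) (F : Forest n β) :
    (remove x F).weight ≤ F.weight :=
  (List.filter_sublist.map _).sum_le_sum fun _ _ => Nat.zero_le _

theorem weight_remove {x : Fin n × Fin n} {t : Tour n β} {p : List Bool} (h : t ∈ F)
    (ht : t.addr x = some p) : (remove x F).weight + (t.size + 2) ≤ F.weight := by
  induction F with
  | nil => simp at h
  | cons t' F ih =>
    rcases List.mem_cons.1 h with rfl | h
    · have := weight_remove_le x F
      simp only [remove, List.filter_cons, ht, weight_cons] at this ⊢
      simp only [Option.isNone_some, Bool.false_eq_true, if_false]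
      omega
    · have := ih h
      simp only [remove, List.filter_cons, weight_cons] at this ⊢
      split_ifs
      · rw [weight_cons]
        omega
      · omega

theorem size_add_two_le_weight {t : Tour n β} (h : t ∈ F) : t.size + 2 ≤ F.weight :=
  List.single_le_sum (fun _ _ => Nat.zero_le _) _ (List.mem_map_of_mem h)

theorem Good.size_le (hF : F.Good P N) {t : Tour n β} (h : t ∈ F) : t.size + 2 ≤ N :=
  (size_add_two_le_weight h).trans hF.2

theorem Good.height_le (hF : F.Good P N) (hN : N ≤ 2 ^ b) {t : Tour n β} (h : t ∈ F) :
    t.height ≤ 2 * b :=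
  (hF.1 t h).height_le (by have := hF.size_le h; omega)

theorem good_cons {t : Tour n β} (ht : t.Good P) (hF : ∀ t ∈ F, t.Good P)
    (h : t.size + 2 + F.weight ≤ N) : Good P N (t :: F) :=
  ⟨List.forall_mem_cons.2 ⟨ht, hF⟩, h⟩

theorem lookup_eq_some {x : Fin n × Fin n} {t : Tour n β} {p : List Bool}
    (h : lookup x F = some (t, p)) : t ∈ F ∧ t.addr x = some p := by
  obtain ⟨t', ht', h⟩ := List.exists_of_findSome?_eq_some h
  simp only [Option.map_eq_some_iff, Prod.mk.injEq] at h
  obtain ⟨p', hp', rfl, rfl⟩ := h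
  exact ⟨ht', hp'⟩

/-- A bound on the cost of each of the operations on balanced trees of height at most `2 * b`, if
creating a node costs `d`. -/
def opCost (d b : ℕ) : ℕ := 20 * ((d + 1) * (b + 1))

theorem le_opCost {x y d b : ℕ} (hx : x ≤ 20) (hy : y ≤ 20) :
    x * b + y * (d * b) + x + y * d ≤ opCost d b := by
  have h1 := Nat.mul_le_mul_right (b + 1) hx
  have h2 := Nat.mul_le_mul_right (d * (b + 1)) hy
  unfold opCost
  linarith

theorem findRoot_spec (hF : F.Good P N) (hN : N ≤ 2 ^ b) (x : Fin n × Fin n) :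
    (findRoot x F).Spec (2 * b + 1) fun o => o = lookup x F := by
  unfold findRoot
  cases h : lookup x F with
  | none => exact ⟨Nat.le_add_left _ _, rfl⟩
  | some y =>
    obtain ⟨t, p⟩ := y
    obtain ⟨h1, h2⟩ := lookup_eq_some h
    have h3 := Tree.length_addr_lt (hF.1 t h1) h2
    have h4 := hF.height_le hN h1
    exact ⟨show p.length + 1 ≤ _ by omega, rfl⟩

theorem connected_spec (hF : F.Good P N) (hN : N ≤ 2 ^ b) (u v : Fin n) :
    (connected u v F).Spec (4 * b + 3) fun c =>
      c = false → ∀ t p, lookup (u, u) F = some (t, p) → t.addr (v, v) = none := by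
  refine (Spec.tick_bind (n' := (2 * b + 1) + (2 * b + 1)) ?_).weaken (by omega)
  refine (findRoot_spec hF hN _).bind fun o ho => ?_
  refine (findRoot_spec hF hN _).bind_of_le le_rfl fun o' _ => Spec.pure ?_
  rintro h t p h'
  subst ho
  simpa [h'] using h

theorem link_spec (hA : A.Measured P N d) (hF : F.Good P N) (hN : N ≤ 2 ^ b) (u v : Fin n)
    {x y : β} (hx : P 1 x) (hy : P 1 y) :
    (link A u v x y F).Spec (10 * opCost d b) (Good P N) := by
  have c1 := le_opCost (x := 4) (y := 0) (d := d) (b := b) (by norm_num) (by norm_num)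
  have c2 := le_opCost (x := 2) (y := 20) (d := d) (b := b) (by norm_num) (by norm_num)
  have c3 : d + 3 * d * (2 * b) = 6 * (d * b) + d := by ring
  have c4 : 1 + d + (1 + 6 * d) * (2 * b) = 2 * b + 12 * (d * b) + 1 + d := by ring
  have c5 : 1 + (1 + 10 * d) * (2 * b) = 2 * b + 20 * (d * b) + 1 := by ring
  unfold link
  refine (connected_spec hF hN u v).bind_of_le (by omega) fun c hc => ?_
  split_ifs with h
  · exact Spec.pure hF
  refine (findRoot_spec hF hN _).bind_of_le (by omega) fun o₁ ho₁ => ?_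
  refine (findRoot_spec hF hN _).bind_of_le (by omega) fun o₂ ho₂ => ?_
  match o₁, o₂ with
  | none, none => exact Spec.pure hF
  | some _, none => exact Spec.pure hF
  | none, some _ => exact Spec.pure hF
  | some (tu, pu), some (tv, pv) =>
    have huv := hc (by simpa using h) tu pu ho₁.symm
    obtain ⟨mu, au⟩ := lookup_eq_some ho₁.symm
    obtain ⟨mv, av⟩ := lookup_eq_some ho₂.symm
    -- `tu` is still there when the tour of `v` has been removed, as it does not contain `v`
    have w1 := weight_remove mv av
    have w2 := weight_remove (mem_remove mu huv) au
    have w3 := hF.2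
    refine (Tree.splitAt_spec hA (hF.1 _ mu) (by omega) pu (hF.height_le hN mu)).bind_of_le
      (by omega) fun s₁ hs₁ => ?_
    refine (Tree.splitAt_spec hA (hF.1 _ mv) (by omega) pv (hF.height_le hN mv)).bind_of_le
      (by omega) fun s₂ hs₂ => ?_
    match s₁, s₂ with
    | none, none => exact Spec.pure hF
    | some _, none => exact Spec.pure hF
    | none, some _ => exact Spec.pure hF
    | some (l, ku, xu, r), some (l', kv, xv, r') =>
      obtain ⟨gl, gr, gxu, su, hl, hr⟩ := hs₁ _ _ _ _ rfl
      obtain ⟨gl', gr', gxv, sv, hl', hr'⟩ := hs₂ _ _ _ _ rfl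
      have bd {t : Tour n β} (ht : t.Good P) (hs : t.size + 1 ≤ N) : t.height ≤ 2 * b :=
        ht.height_le (by omega)
      refine (Tree.append_spec hA gr' gl' (by omega) hr' hl').bind_of_le (by omega)
        fun a ⟨ga, sa⟩ => ?_
      refine (Tree.join_spec_of_height_le hA (l := .nil) trivial ga gxv (by simp; omega)
        (by simp) (bd ga (by omega))).bind_of_le (by omega) fun b' ⟨gb, sb, _⟩ => ?_
      rw [Tree.size_nil] at sb
      refine (Tree.join_spec_of_height_le hA gb gr hy (by omega)
        (bd gb (by omega)) hr).bind_of_le (by omega) fun c ⟨gc, sc, _⟩ => ?_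
      refine (Tree.join_spec_of_height_le hA (l := .nil) trivial gc hx (by simp; omega)
        (by simp) (bd gc (by omega))).bind_of_le (by omega) fun d' ⟨gd, sd, _⟩ => ?_
      rw [Tree.size_nil] at sd
      refine (Tree.join_spec_of_height_le hA gl gd gxu (by omega)
        hl (bd gd (by omega))).bind_of_le (by omega) fun e ⟨ge, se, _⟩ => ?_
      exact Spec.pure (good_cons ge
        (fun t ht => hF.1 t (mem_of_mem_remove (mem_of_mem_remove ht))) (by omega))

theorem cut_spec (hA : A.Measured P N d) (hF : F.Good P N) (hN : N ≤ 2 ^ b) (u v : Fin n) :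
    (cut A u v F).Spec (5 * opCost d b) (Good P N) := by
  have c1 := le_opCost (x := 2) (y := 0) (d := d) (b := b) (by norm_num) (by norm_num)
  have c2 := le_opCost (x := 2) (y := 20) (d := d) (b := b) (by norm_num) (by norm_num)
  have c4 : 1 + d + (1 + 6 * d) * (2 * b) = 2 * b + 12 * (d * b) + 1 + d := by ring
  have c5 : 1 + (1 + 10 * d) * (2 * b) = 2 * b + 20 * (d * b) + 1 := by ring
  unfold cut
  refine (findRoot_spec hF hN _).bind_of_le (by omega) fun o ho => ?_
  match o with
  | none => exact Spec.pure hF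
  | some (t, p) =>
    obtain ⟨mt, at'⟩ := lookup_eq_some ho.symm
    have w1 := weight_remove mt at'
    have w2 := hF.2
    have hrem : ∀ t ∈ remove (u, v) F, t.Good P := fun t ht => hF.1 t (mem_of_mem_remove ht)
    refine (Tree.splitAt_spec hA (hF.1 _ mt) (by omega) p (hF.height_le hN mt)).bind_of_le
      (by omega) fun s hs => ?_
    match s with
    | none => exact Spec.pure hF
    | some (l, ku, xu, r) =>
      obtain ⟨gl, gr, gx, st, hl, hr⟩ := hs _ _ _ _ rfl
      dsimp only
      cases hlv : l.addr (v, u) with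
      | some q =>
        have hq := Tree.length_addr_lt gl hlv
        refine (Spec.tick_bind (n' := 3 * opCost d b - (2 * b + 1)) ?_).weaken (by omega)
        refine (Tree.splitAt_spec hA gl (by omega) q hl).bind_of_le (by omega) fun s' hs' => ?_
        match s' with
        | none => exact Spec.pure hF
        | some (a, kv, xv, b') =>
          obtain ⟨ga, gb, gx', sl, ha, hb⟩ := hs' _ _ _ _ rfl
          refine (Tree.append_spec hA ga gr (by omega) ha hr).bind_of_le (by omega)
            fun c ⟨gc, sc⟩ => Spec.pure ?_
          exact good_cons gb (List.forall_mem_cons.2 ⟨gc, hrem⟩) (by rw [weight_cons]; omega)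
      | none =>
        cases hrv : r.addr (v, u) with
        | none => exact Spec.pure hF
        | some q =>
          have hq := Tree.length_addr_lt gr hrv
          refine (Spec.tick_bind (n' := 3 * opCost d b - (2 * b + 1)) ?_).weaken (by omega)
          refine (Tree.splitAt_spec hA gr (by omega) q hr).bind_of_le (by omega)
            fun s' hs' => ?_
          match s' with
          | none => exact Spec.pure hF
          | some (b', kv, xv, c) =>
            obtain ⟨gb, gc, gx', sl, hb, hc⟩ := hs' _ _ _ _ rfl
            refine (Tree.append_spec hA gl gc (by omega) hl hc).bind_of_le (by omega)
              fun a ⟨ga, sa⟩ => Spec.pure ?_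
            exact good_cons gb (List.forall_mem_cons.2 ⟨ga, hrem⟩) (by rw [weight_cons]; omega)

end Forest

/-! ### The cutset data structure -/

theorem cutAug_measured (C : Config) (N : ℕ) :
    (cutAug C).Measured (fun _ _ => True) N (4 * (C.cols * C.rows) + 3) where
  unit := trivial
  op {_ _ a b} _ _ _ := by
    refine ⟨?_, trivial⟩
    change 2 * (2 * (C.cols * C.rows) + 1 + 0) + 1 ≤ _
    omega

namespace Cutset

variable {C : Config} {N b X : ℕ} {F : Cutset C}

/-- The invariant of the cutset data structure: the sketches do not matter for the running time. -/
abbrev Good (N : ℕ) (F : Cutset C) : Prop := Forest.Good (fun _ _ => True) N F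

theorem opCost_le (hb : b + 1 ≤ X) (hR : C.cols * C.rows + 1 ≤ X) :
    Forest.opCost (4 * (C.cols * C.rows) + 3) b ≤ 80 * X ^ 2 := by
  have := Nat.mul_le_mul hR hb
  unfold Forest.opCost
  nlinarith

theorem updateVertex_spec (hF : F.Good N) (hN : N ≤ 2 ^ b) (hb : b + 1 ≤ X)
    (hR : C.cols * C.rows + 1 ≤ X) (lev : ℕ) (e : Word C.V) (w : C.Vertex) :
    (updateVertex lev e w F).Spec (20 * X ^ 2) (Good N) := by
  have key : (2 * b + 1) + (1 + (4 * (C.cols * C.rows) + 1) +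
      (4 * (C.cols * C.rows) + 3) * (2 * b)) ≤ 20 * X ^ 2 := by
    have := Nat.mul_le_mul hR hb
    nlinarith
  refine ((Forest.findRoot_spec hF hN _).bind fun o ho => ?_).weaken key
  match o with
  | none => exact Spec.pure hF
  | some (t, p) =>
    obtain ⟨mt, at'⟩ := Forest.lookup_eq_some ho.symm
    have w1 := Forest.weight_remove mt at'
    have w2 := hF.2
    have hh := Nat.mul_le_mul_left (4 * (C.cols * C.rows) + 3) (hF.height_le hN mt)
    refine ((Tree.modifyAt_spec (n := 4 * (C.cols * C.rows) + 1) (cutAug_measured C N)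
      (fun v _ => ⟨le_rfl, trivial⟩) (hF.1 _ mt) (by omega) p).weaken
      (by omega)).bind_of_le le_rfl fun t' ⟨gt, st, _⟩ => Spec.pure ?_
    exact Forest.good_cons gt (fun t ht => hF.1 t (Forest.mem_of_mem_remove ht)) (by omega)

theorem update_spec (hF : F.Good N) (hN : N ≤ 2 ^ b) (hb : b + 1 ≤ X)
    (hR : C.cols * C.rows + 1 ≤ X) (lev : ℕ) (u v : C.Vertex) :
    (update lev u v F).Spec (1 + 40 * X ^ 2) (Good N) := by
  refine Spec.tick_bind ?_
  refine (updateVertex_spec hF hN hb hR lev _ u).bind_of_le (by omega) fun F' hF' => ?_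
  exact (updateVertex_spec hF' hN hb hR lev _ v).weaken (by omega)

theorem link_spec (hF : F.Good N) (hN : N ≤ 2 ^ b) (hb : b + 1 ≤ X)
    (hR : C.cols * C.rows + 1 ≤ X) (u v : C.Vertex) :
    (link u v F).Spec (900 * X ^ 2) (Good N) := by
  have h1 := opCost_le hb hR
  have h2 : X ≤ X ^ 2 := Nat.le_self_pow (by norm_num) X
  have zero_spec : (Sketch.zero : Timed (Sketch C)).Spec (2 * (C.cols * C.rows) + 1)
      fun _ => True := ⟨le_rfl, trivial⟩
  refine zero_spec.bind_of_le (by omega) fun x _ => ?_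
  refine zero_spec.bind_of_le (by omega) fun y _ => ?_
  exact (Forest.link_spec (cutAug_measured C N) hF hN u v trivial trivial).weaken (by omega)

theorem cut_spec (hF : F.Good N) (hN : N ≤ 2 ^ b) (hb : b + 1 ≤ X)
    (hR : C.cols * C.rows + 1 ≤ X) (u v : C.Vertex) :
    (cut u v F).Spec (400 * X ^ 2) (Good N) := by
  have h1 := opCost_le hb hR
  exact (Forest.cut_spec (cutAug_measured C N) hF hN u v).weaken (by omega)

theorem componentSize_spec (hF : F.Good N) (hN : N ≤ 2 ^ b) (hb : b + 1 ≤ X) (w : C.Vertex) :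
    (componentSize w F).Spec (2 * X) fun _ => True := by
  refine ((Forest.findRoot_spec hF hN _).bind (n' := 0) fun o _ => ?_).weaken (by omega)
  match o with
  | none => exact Spec.pure trivial
  | some (t, p) => exact Spec.pure trivial

theorem query_spec (hF : F.Good N) (hN : N ≤ 2 ^ b) (hb : b + 1 ≤ X)
    (hR : C.cols * C.rows + 1 ≤ X) (lev : ℕ) (w : C.Vertex) :
    (query lev w F).Spec (6 * X) fun _ => True := by
  refine (Forest.findRoot_spec hF hN _).bind_of_le (by omega) fun o _ => ?_
  match o with
  | none => exact Spec.pure trivial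
  | some (t, p) =>
    exact ⟨show 4 * (C.cols * C.rows) + 1 ≤ _ by omega, trivial⟩

end Cutset

/-! ### Paths -/

theorem pathAug_measured (n N : ℕ) :
    (pathAug n).Measured (fun m a => a.count = m) N 3 where
  unit := rfl
  op h h' _ := ⟨le_rfl, congrArg₂ (· + ·) h h'⟩

namespace Path

variable {n H b : ℕ} {p q : Path n}

/-- The invariant of paths: the path is kept in a balanced tree, in which the counts are correct. -/
abbrev Good (p : Path n) : Prop := Tree.Good (fun m a => a.count = m) p

theorem Good.length_eq (hp : p.Good) : p.length = p.size :=
  Tree.Good.agg (pathAug_measured n 0) hp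

theorem entry_spec (hp : p.Good) (i : ℕ) : (entry p i).Spec (p.height + 1) fun _ => True := by
  induction p generalizing i with
  | nil => exact ⟨le_rfl, trivial⟩
  | node h a l k v r ihl ihr =>
    obtain ⟨gl, gr, rfl, -⟩ := hp
    refine Spec.weaken (Spec.tick_bind (n' := max l.height r.height + 1) ?_)
      (by rw [Tree.height_node]; omega)
    split_ifs
    · exact (ihl gl i).weaken (by omega)
    · exact Spec.pure trivial
    · exact (ihr gr _).weaken (by omega)

theorem takeDrop_spec (hp : p.Good) (i : ℕ) (hH : p.height ≤ H) :
    (takeDrop p i).Spec (1 + (4 + 9 * H) * p.height) fun y =>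
      Good y.1 ∧ Good y.2 ∧ y.1.size + y.2.size = p.size ∧
      y.1.height ≤ p.height ∧ y.2.height ≤ p.height := by
  induction p generalizing i with
  | nil => exact ⟨Nat.le_add_right _ _, trivial, trivial, rfl, le_rfl, le_rfl⟩
  | node h a l k v r ihl ihr =>
    obtain ⟨gl, gr, rfl, b1, b2, -, gv⟩ := hp
    simp only [Tree.height_node, Tree.size_node] at *
    rw [mul_add_one]
    have e1 := Nat.mul_le_mul_left (4 + 9 * H) (le_max_left l.height r.height)
    have e2 := Nat.mul_le_mul_left (4 + 9 * H) (le_max_right l.height r.height)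
    refine Spec.tick_bind ?_
    split_ifs
    · refine ((ihl gl i (by omega)).bind (n' := 3 + 9 * H)
        fun (a, b) ⟨ga, gb, hs, ha, hb⟩ => ?_).weaken (by omega)
      refine (Tree.join_spec_of_height_le (H := H) (pathAug_measured n _) gb gr gv le_rfl
        (by omega) (by omega)).bind_of_le (by omega) fun t ⟨gt, st, f1, f2⟩ => Spec.pure ?_
      dsimp only at *
      exact ⟨ga, gt, by omega, by omega, by omega⟩
    · refine ((ihr gr _ (by omega)).bind (n' := 3 + 9 * H)
        fun (a, b) ⟨ga, gb, hs, ha, hb⟩ => ?_).weaken (by omega)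
      refine (Tree.join_spec_of_height_le (H := H) (pathAug_measured n _) gl ga gv le_rfl
        (by omega) (by omega)).bind_of_le (by omega) fun t ⟨gt, st, f1, f2⟩ => Spec.pure ?_
      dsimp only at *
      exact ⟨gt, gb, by omega, by omega, by omega⟩

theorem overlap_spec (hp : p.Good) (hq : q.Good) (hpH : p.height ≤ H) (hqH : q.height ≤ H)
    (fuel lo hi : ℕ) :
    (overlap p q fuel lo hi).Spec (fuel * (2 * H + 3) + 1) fun _ => True := by
  induction fuel generalizing lo hi with
  | zero => exact Spec.pure trivial
  | succ fuel ih =>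
    rw [overlap]
    split_ifs
    · exact ⟨Nat.le_add_left _ _, trivial⟩
    · rw [add_one_mul]
      refine Spec.weaken (Spec.tick_bind (n' := fuel * (2 * H + 3) + 1 + (2 * H + 2)) ?_)
        (by omega)
      refine (entry_spec hp _).bind_of_le (by omega) fun a _ => ?_
      refine (entry_spec hq _).bind_of_le (by omega) fun b _ => ?_
      split_ifs
      · exact (ih _ _).weaken (by omega)
      · exact (ih _ _).weaken (by omega)

/-- Concatenating costs `O(log² V)`: the binary search for the part that cancels has `O(log V)`
rounds, and each looks up two entries in balanced trees. -/
theorem concat_spec (hp : p.Good) (hq : q.Good) (hN : p.size + q.size < 2 ^ b) :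
    (concat p q).Spec (100 * (b + 1) ^ 2) fun t => Good t ∧ t.size ≤ p.size + q.size := by
  have hpH : p.height ≤ 2 * b := Tree.Good.height_le hp (by omega)
  have hqH : q.height ≤ 2 * b := Tree.Good.height_le hq (by omega)
  have hfuel : Nat.log 2 (min p.length q.length) + 1 ≤ b + 1 := by
    rw [hp.length_eq, hq.length_eq]
    have : Nat.log 2 (min p.size q.size) ≤ Nat.log 2 (2 ^ b) := Nat.log_mono_right (by omega)
    rw [Nat.log_pow (by norm_num)] at this
    omega
  have c1 := Nat.mul_le_mul_right (2 * (2 * b) + 3) hfuel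
  have c2 := Nat.mul_le_mul_left (4 + 9 * (2 * b)) hpH
  have c3 := Nat.mul_le_mul_left (4 + 9 * (2 * b)) hqH
  have key : ((b + 1) * (2 * (2 * b) + 3) + 1) + ((1 + (4 + 9 * (2 * b)) * (2 * b)) +
      ((1 + (4 + 9 * (2 * b)) * (2 * b)) + (1 + 3 + (1 + 6 * 3) * (2 * b)))) ≤
      100 * (b + 1) ^ 2 := by
    nlinarith
  refine Spec.weaken ?_ key
  refine ((overlap_spec hp hq hpH hqH _ _ _).weaken (by omega)).bind fun k _ => ?_
  refine ((takeDrop_spec hp _ hpH).weaken (by omega)).bind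
    fun (p₁, p₂) ⟨g1, g2, hs, h1, h2⟩ => ?_
  refine ((takeDrop_spec hq _ hqH).weaken (by omega)).bind
    fun (q₂, q₁) ⟨g1', g2', hs', h1', h2'⟩ => ?_
  exact (Tree.append_spec (pathAug_measured n _) g1 g2' le_rfl (by omega) (by omega)).mono le_rfl
    fun t ⟨gt, st⟩ => ⟨gt, by omega⟩

end Path

/-! ### The dynamic tree -/

/-- The path represented by a stretch of a tour has at most as many edges as the stretch has
entries. -/
theorem treeAug_measured {n N b : ℕ} (hN : N < 2 ^ b) :
    (treeAug n).Measured (fun m p => Path.Good p ∧ p.size ≤ m) N (201 * (b + 1) ^ 2) where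
  unit := ⟨trivial, le_rfl⟩
  op {m m' p q} hp hq h := by
    have hs := Path.concat_spec (b := b) hp.1 hq.1 (by omega)
    have hb : 1 ≤ (b + 1) ^ 2 := Nat.one_le_pow _ _ (by omega)
    have h1 := hs.1
    have h2 := hs.2.2
    refine ⟨?_, hs.2.1, ?_⟩
    · change 2 * (Path.concat p q).steps + 1 ≤ _
      omega
    · change (Path.concat p q).val.size ≤ _
      omega

namespace DynTree

variable {n N b X : ℕ} {T : DynTree n}

/-- The invariant of the dynamic tree. -/
abbrev Good (N : ℕ) (T : DynTree n) : Prop :=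
  Forest.Good (fun m p => Path.Good p ∧ p.size ≤ m) N T

theorem opCost_le (hb : b + 1 ≤ X) :
    Forest.opCost (201 * (b + 1) ^ 2) b ≤ 4040 * X ^ 3 := by
  have h1 : 1 ≤ (b + 1) ^ 2 := Nat.one_le_pow _ _ (by omega)
  have h2 : (b + 1) ^ 3 ≤ X ^ 3 := Nat.pow_le_pow_left hb 3
  unfold Forest.opCost
  nlinarith

theorem link_spec (hT : T.Good N) (hN : N < 2 ^ b) (hb : b + 1 ≤ X) (u v : Fin n) (w : ℕ) :
    (link u v w T).Spec (50000 * X ^ 3) (Good N) := by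
  have h1 := opCost_le hb
  have hs (u v : Fin n) : (Path.single u v w).Good ∧ (Path.single u v w).size ≤ 1 :=
    ⟨⟨trivial, trivial, rfl, Nat.zero_le _, Nat.zero_le _, rfl, rfl⟩, le_rfl⟩
  exact (Forest.link_spec (treeAug_measured hN) hT hN.le u v (hs u v) (hs v u)).weaken (by omega)

theorem cut_spec (hT : T.Good N) (hN : N < 2 ^ b) (hb : b + 1 ≤ X) (u v : Fin n) :
    (cut u v T).Spec (50000 * X ^ 3) (Good N) := by
  have h1 := opCost_le hb
  exact (Forest.cut_spec (treeAug_measured hN) hT hN.le u v).weaken (by omega)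

theorem pathQuery_spec (hT : T.Good N) (hN : N < 2 ^ b) (hb : b + 1 ≤ X) (u v : Fin n) :
    (pathQuery u v T).Spec (50000 * X ^ 3) fun y => Good N y.2 := by
  have hA := treeAug_measured (n := n) hN
  have c0 := opCost_le hb
  generalize 201 * (b + 1) ^ 2 = d at hA c0
  have c1 := Forest.le_opCost (x := 2) (y := 0) (d := d) (b := b) (by norm_num) (by norm_num)
  have c2 := Forest.le_opCost (x := 2) (y := 20) (d := d) (b := b) (by norm_num) (by norm_num)
  have c3 : d + 3 * d * (2 * b) = 6 * (d * b) + d := by ring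
  have c5 : 1 + (1 + 10 * d) * (2 * b) = 2 * b + 20 * (d * b) + 1 := by ring
  refine Spec.weaken (n := 6 * Forest.opCost d b) ?_ (by omega)
  unfold pathQuery
  refine (Forest.findRoot_spec hT hN.le _).bind_of_le (by omega) fun o ho => ?_
  match o with
  | none => exact Spec.pure hT
  | some (t, p) =>
    obtain ⟨mt, at'⟩ := Forest.lookup_eq_some ho.symm
    have w1 := Forest.weight_remove mt at'
    have w2 := hT.2
    have hrem : ∀ t ∈ Forest.remove (u, u) T, t.Good _ :=
      fun t ht => hT.1 t (Forest.mem_of_mem_remove ht)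
    refine (Tree.splitAt_spec hA (hT.1 _ mt) (by omega) p (hT.height_le hN.le mt)).bind_of_le
      (by omega) fun s hs => ?_
    match s with
    | none => exact Spec.pure hT
    | some (l, ku, xu, r) =>
      obtain ⟨gl, gr, gx, st, hl, hr⟩ := hs _ _ _ _ rfl
      dsimp only
      cases hlv : l.addr (v, v) with
      | some q =>
        have hq := Tree.length_addr_lt gl hlv
        refine (Spec.tick_bind (n' := 4 * Forest.opCost d b - (2 * b + 1)) ?_).weaken (by omega)
        refine (Tree.splitAt_spec hA gl (by omega) q hl).bind_of_le (by omega) fun s' hs' => ?_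
        match s' with
        | none => exact Spec.pure hT
        | some (l', kv, xv, m) =>
          obtain ⟨gl', gm, gx', sl, hl', hm⟩ := hs' _ _ _ _ rfl
          refine (Tree.join_spec_of_height_le hA gl' gm gx' (by omega) hl' hm).bind_of_le
            (by omega) fun a ⟨ga, sa, _⟩ => ?_
          refine (Tree.join_spec_of_height_le hA ga gr gx (by omega)
            (ga.height_le (by omega)) hr).bind_of_le (by omega) fun t' ⟨gt, st', _⟩ => Spec.pure ?_
          exact Forest.good_cons gt hrem (by omega)
      | none =>
        cases hrv : r.addr (v, v) with
        | none => exact Spec.pure hT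
        | some q =>
          have hq := Tree.length_addr_lt gr hrv
          refine (Spec.tick_bind (n' := 4 * Forest.opCost d b - (2 * b + 1)) ?_).weaken
            (by omega)
          refine (Tree.splitAt_spec hA gr (by omega) q hr).bind_of_le (by omega)
            fun s' hs' => ?_
          match s' with
          | none => exact Spec.pure hT
          | some (m, kv, xv, r') =>
            obtain ⟨gm, gr', gx', sr, hm, hr'⟩ := hs' _ _ _ _ rfl
            refine (Tree.join_spec_of_height_le hA gm gr' gx' (by omega) hm hr').bind_of_le
              (by omega) fun a ⟨ga, sa, _⟩ => ?_
            refine (Tree.join_spec_of_height_le hA gl ga gx (by omega) hl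
              (ga.height_le (by omega))).bind_of_le (by omega)
              fun t' ⟨gt, st', _⟩ => Spec.pure ?_
            exact Forest.good_cons gt hrem (by omega)

end DynTree

/-! ### The connectivity algorithm -/

section Algorithm

variable {C : Config} {N b X : ℕ} {s : State C}

/-- The invariant of the states of the algorithm: each of its forests is `Good`. -/
def State.Good (N : ℕ) (s : State C) : Prop := (∀ j, Cutset.Good N (s.level j)) ∧ s.T.Good N

theorem State.Good.update (hs : s.Good N) (j : Fin (C.top + 1)) {F : Cutset C} (hF : F.Good N) :
    State.Good N { s with level := Function.update s.level j F } := by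
  refine ⟨fun i => ?_, hs.2⟩
  rcases eq_or_ne i j with rfl | h
  · simpa using hF
  · simpa [h] using hs.1 i

theorem State.good_init (C : Config) : (State.init C).Good (3 * C.V) := by
  constructor
  · refine fun j => ⟨fun t ht => ?_, ?_⟩
    · obtain ⟨w, -, rfl⟩ := List.mem_map.1 ht
      exact ⟨trivial, trivial, rfl, Nat.zero_le _, Nat.zero_le _, trivial, trivial⟩
    · refine le_of_eq ?_
      simp [Forest.weight, State.init, Function.comp_def, mul_comm]
  · refine ⟨fun t ht => ?_, ?_⟩
    · obtain ⟨w, -, rfl⟩ := List.mem_map.1 ht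
      exact ⟨trivial, trivial, rfl, Nat.zero_le _, Nat.zero_le _,
        ⟨trivial, Nat.zero_le _⟩, trivial, Nat.zero_le _⟩
    · refine le_of_eq ?_
      simp [Forest.weight, State.init, Function.comp_def, mul_comm]

/-- A bound on the cost of the work on level `j`: operations on the dynamic tree are made on the top
level only. The constants are large enough for a cut, for a link, and for an update together with a
cut. -/
def levelCost (C : Config) (X : ℕ) (j : Fin (C.top + 1)) : ℕ :=
  1000 * X ^ 2 + if j = Fin.last C.top then 50000 * X ^ 3 else 0

/-- As the more expensive operations on the dynamic tree occur just once, they do not dominate the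
cost of a pass through the levels. -/
theorem sum_levelCost_le (htop : C.top + 1 ≤ X) :
    ((List.finRange (C.top + 1)).map (levelCost C X)).sum ≤ 51000 * X ^ 3 := by
  rw [← List.ofFn_eq_map, List.sum_ofFn]
  simp only [levelCost, Finset.sum_add_distrib, Finset.sum_const, Finset.card_univ,
    Fintype.card_fin, smul_eq_mul, Finset.sum_ite_eq', Finset.mem_univ, if_true]
  have := Nat.mul_le_mul_right (1000 * X ^ 2) htop
  nlinarith

theorem sum_levelCost_levelsFrom_le (htop : C.top + 1 ≤ X) (m : ℕ) :
    ((levelsFrom C m).map (levelCost C X)).sum ≤ 51000 * X ^ 3 :=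
  ((List.filter_sublist.map _).sum_le_sum fun _ _ => Nat.zero_le _).trans (sum_levelCost_le htop)

theorem cutLevel_spec (hN : N < 2 ^ b) (hb : b + 1 ≤ X)
    (hR : C.cols * C.rows + 1 ≤ X) (hs : s.Good N) (u v : C.Vertex) (j : Fin (C.top + 1)) :
    (cutLevel u v s j).Spec (500 * X ^ 2 + if j = Fin.last C.top then 50000 * X ^ 3 else 0)
      (State.Good N) := by
  have hX : 1 ≤ X ^ 2 := Nat.one_le_pow _ _ (by omega)
  refine Spec.weaken (Spec.tick_bind (n' := 400 * X ^ 2 +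
    if j = Fin.last C.top then 50000 * X ^ 3 else 0) ?_) (by omega)
  refine (Cutset.cut_spec (hs.1 j) hN.le hb hR u v).bind fun F hF => ?_
  have hs' := hs.update j hF
  dsimp only
  split_ifs
  · exact (DynTree.cut_spec hs'.2 hN hb u v).bind_of_le le_rfl
      fun T hT => Spec.pure ⟨hs'.1, hT⟩
  · exact Spec.pure hs'

theorem linkLevel_spec (hN : N < 2 ^ b) (hb : b + 1 ≤ X)
    (hR : C.cols * C.rows + 1 ≤ X) (hs : s.Good N) (u v : C.Vertex) (w : ℕ) (j : Fin (C.top + 1)) :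
    (linkLevel u v w s j).Spec (levelCost C X j) (State.Good N) := by
  have hX : 1 ≤ X ^ 2 := Nat.one_le_pow _ _ (by omega)
  unfold levelCost
  refine Spec.weaken (Spec.tick_bind (n' := 900 * X ^ 2 +
    if j = Fin.last C.top then 50000 * X ^ 3 else 0) ?_) (by omega)
  refine (Cutset.link_spec (hs.1 j) hN.le hb hR u v).bind fun F hF => ?_
  have hs' := hs.update j hF
  dsimp only
  split_ifs
  · exact (DynTree.link_spec hs'.2 hN hb u v w).bind_of_le le_rfl
      fun T hT => Spec.pure ⟨hs'.1, hT⟩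
  · exact Spec.pure hs'

theorem updateLevel_spec (hN : N < 2 ^ b) (hb : b + 1 ≤ X)
    (hR : C.cols * C.rows + 1 ≤ X) (hs : s.Good N) (u v : C.Vertex) (deletion : Bool)
    (i : Fin (C.top + 1)) :
    (updateLevel u v deletion s i).Spec (levelCost C X i) (State.Good N) := by
  have hX : 1 ≤ X ^ 2 := Nat.one_le_pow _ _ (by omega)
  unfold levelCost
  refine Spec.weaken (Spec.tick_bind (n' := (1 + 40 * X ^ 2) + (1 + (500 * X ^ 2 +
    if i = Fin.last C.top then 50000 * X ^ 3 else 0))) ?_) (by omega)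
  refine (Cutset.update_spec (hs.1 i) hN.le hb hR _ u v).bind fun F hF => ?_
  have hs' := hs.update i hF
  have he : (Forest.hasEdge u v F).Spec 1 fun _ => True := ⟨le_rfl, trivial⟩
  refine he.bind fun e _ => ?_
  by_cases hd : (deletion && e) = true
  · rw [if_pos hd]
    exact cutLevel_spec hN hb hR hs' u v i
  · rw [if_neg hd]
    exact Spec.pure hs'

theorem removeCycleEdge_spec (hN : N < 2 ^ b) (hb : b + 1 ≤ X)
    (hR : C.cols * C.rows + 1 ≤ X) (htop : C.top + 1 ≤ X) (hs : s.Good N) (u v : C.Vertex) :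
    (removeCycleEdge u v s).Spec (110000 * X ^ 3) (State.Good N) := by
  have hX : X ≤ X ^ 3 := Nat.le_self_pow (by norm_num) X
  refine (Forest.connected_spec hs.2 hN.le u v).bind_of_le (by omega) fun c _ => ?_
  split_ifs
  · refine (DynTree.pathQuery_spec hs.2 hN hb u v).bind_of_le (by omega) fun (e, T) hT => ?_
    have hs' : State.Good N { s with T := T } := ⟨hs.1, hT⟩
    match e with
    | none => exact Spec.pure hs'
    | some (uCut, vCut, lev) =>
      have h := sum_levelCost_levelsFrom_le htop lev
      refine (Spec.foldlM (fun s j hs => (cutLevel_spec hN hb hR hs uCut vCut j).weaken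
        (n' := levelCost C X j) ?_) _ _ hs').weaken (by omega)
      unfold levelCost
      omega
  · exact Spec.pure hs

theorem processVertex_spec (hN : N < 2 ^ b) (hb : b + 1 ≤ X)
    (hR : C.cols * C.rows + 1 ≤ X) (htop : C.top + 1 ≤ X) (i : Fin C.top)
    (x : State C × Bool) (hx : x.1.Good N) (w : C.Vertex) :
    (processVertex i x w).FlagSpec x.2 (200000 * X ^ 3) (11 * X) (State.Good N) := by
  have hX : X ≤ X ^ 3 := Nat.le_self_pow (by norm_num) X
  have ht : (tick 1).Spec 1 fun _ => True := ⟨le_rfl, trivial⟩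
  refine FlagSpec.weaken (big := 1 + (2 * X + (2 * X + (6 * X + 161000 * X ^ 3))))
    (small := 1 + (2 * X + (2 * X + (6 * X + 0)))) ?_ (by omega) (by omega)
  refine FlagSpec.bind ht fun _ _ => ?_
  refine FlagSpec.bind (Cutset.componentSize_spec (hx.1 _) hN.le hb w) fun size _ => ?_
  refine FlagSpec.bind (Cutset.componentSize_spec (hx.1 _) hN.le hb w) fun size' _ => ?_
  refine FlagSpec.bind (Cutset.query_spec (hx.1 _) hN.le hb hR i.val w) fun q _ => ?_
  match q with
  | none => exact FlagSpec.pure hx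
  | some (uLink, vLink) =>
    dsimp only
    split_ifs
    · have h := sum_levelCost_levelsFrom_le htop (i.val + 1)
      refine FlagSpec.of_flag_set ?_
      refine (removeCycleEdge_spec hN hb hR htop hx uLink vLink).bind_of_le (by omega)
        fun s hs => ?_
      refine (Spec.foldlM (fun s j hs => linkLevel_spec hN hb hR hs uLink vLink (i.val + 1) j)
        _ s hs).bind_of_le (by omega) fun s' hs' => Spec.pure ⟨hs', rfl⟩
    · exact FlagSpec.pure hx

/-- The first loop costs `O(log³ V)`. The second one costs `O(log² V)` if no isolated
component is found, as then only sketches are queried; each of the `O(log V)` isolated components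
costs further `O(log³ V)`. -/
theorem process_spec (hN : N < 2 ^ b) (hb : b + 1 ≤ X)
    (hR : C.cols * C.rows + 1 ≤ X) (htop : C.top + 1 ≤ X) (hs : s.Good N) (x : EdgeUpdate C) :
    (process s x).FlagSpec false (600000 * X ^ 4) (600000 * X ^ 3) (State.Good N) := by
  have h1 := sum_levelCost_le htop
  have ht : C.top ≤ X := by omega
  have h2 := Nat.mul_le_mul_right (2 * (200000 * X ^ 3)) ht
  have h3 := Nat.mul_le_mul_right (2 * (11 * X)) ht
  have h4 : X ^ 3 ≤ X ^ 4 := Nat.pow_le_pow_right (by omega) (by norm_num)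
  have h5 : X ^ 2 ≤ X ^ 3 := Nat.pow_le_pow_right (by omega) (by norm_num)
  have loop : (process s x).FlagSpec false
      (51000 * X ^ 3 + C.top * (2 * (200000 * X ^ 3)))
      (51000 * X ^ 3 + C.top * (2 * (11 * X))) (State.Good N) := by
    refine FlagSpec.bind ((Spec.foldlM (fun s i hs =>
      updateLevel_spec hN hb hR hs x.u x.v x.deletion i) _ s hs).weaken h1) fun s hs => ?_
    have := FlagSpec.foldlM (fun y i hy => FlagSpec.foldlM
      (fun y w hy => processVertex_spec hN hb hR htop i y hy w) [x.u, x.v] y hy)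
      (List.finRange C.top) (s, false) hs
    rwa [List.length_finRange] at this
  exact loop.weaken (by nlinarith) (by nlinarith)

end Algorithm

theorem three_mul_lt_two_pow {V : ℕ} (hV : 1 ≤ V) : 3 * V < 2 ^ (Nat.clog 2 V + 2) := by
  have := Nat.le_pow_clog (b := 2) (by norm_num) V
  rw [pow_add]
  omega

theorem Reachable.good {C : Config} (hV : 1 ≤ C.V) {E : Set (Sym2 C.Vertex)} {s : State C}
    (h : Reachable E s) : s.Good (3 * C.V) := by
  induction h with
  | init => exact State.good_init C
  | step E s x _ _ ih =>
    exact (process_spec (X := (Nat.clog 2 C.V + 3) + (C.cols * C.rows + 1) + (C.top + 1))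
      (three_mul_lt_two_pow hV) (by omega) (by omega) (by omega) ih x).1.2

theorem clog_le_three_mul_log {V : ℕ} (hV : 2 ≤ V) :
    (Nat.clog 2 V : ℝ) ≤ 3 * Real.log V := by
  have hlog : Real.log 2 ≤ Real.log V := Real.log_le_log (by norm_num) (by exact_mod_cast hV)
  have h1 : 1 ≤ Nat.clog 2 V := Nat.clog_pos (by norm_num) hV
  have h2 : (2 : ℝ) ^ (Nat.clog 2 V - 1) ≤ V := by
    exact_mod_cast (Nat.pow_pred_clog_lt_self (by norm_num) hV).le
  have h3 := Real.log_le_log (by positivity) h2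
  rw [Real.log_pow, Nat.cast_sub h1, Nat.cast_one] at h3
  have h4 := Real.log_two_gt_d9
  have h5 : (1 : ℝ) ≤ Nat.clog 2 V := by exact_mod_cast h1
  nlinarith

end Gibb

theorem mainTheorem4 (K : ℝ) :
    ∃ c : ℝ, ∀ C : Gibb.Config, 2 ≤ C.V →
      (C.top : ℝ) ≤ K * Real.log C.V →
      (C.rows : ℝ) ≤ K * Real.log C.V →
      (C.cols : ℝ) ≤ K →
      ∀ (E : Set (Sym2 C.Vertex)) (s : Gibb.State C) (x : Gibb.EdgeUpdate C),
        Gibb.Reachable E s → x.Allowed E →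
          (Gibb.IsIsolated s x → (Gibb.updateTime s x : ℝ) ≤ c * Real.log C.V ^ 4) ∧
          (Gibb.IsNormal s x → (Gibb.updateTime s x : ℝ) ≤ c * Real.log C.V ^ 3) := by
  -- `X` bounds the heights, the number of levels and the size of a sketch, all at the same time.
  refine ⟨600000 * (11 + K ^ 2 + K) ^ 4, fun C hV htop hrows hcols E s x hs _ => ?_⟩
  obtain ⟨X, hX⟩ : ∃ X : ℕ, X = (Nat.clog 2 C.V + 3) + (C.cols * C.rows + 1) + (C.top + 1) :=
    ⟨_, rfl⟩
  have hlog : (0.69 : ℝ) ≤ Real.log C.V := by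
    have h1 : Real.log 2 ≤ Real.log C.V :=
      Real.log_le_log (by norm_num) (by exact_mod_cast hV)
    linarith [Real.log_two_gt_d9]
  have hK : 0 ≤ K := (Nat.cast_nonneg _).trans hcols
  have hXle : (X : ℝ) ≤ (11 + K ^ 2 + K) * Real.log C.V := by
    have h1 := Gibb.clog_le_three_mul_log hV
    have h2 := mul_le_mul hcols hrows (Nat.cast_nonneg _) hK
    rw [hX]
    push_cast
    nlinarith
  obtain ⟨⟨hbig, -⟩, hsmall⟩ := Gibb.process_spec (X := X)
    (Gibb.three_mul_lt_two_pow (by omega)) (by omega) (by omega) (by omega)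
    (hs.good (by omega)) x
  constructor
  · intro _
    have h1 : (Gibb.updateTime s x : ℝ) ≤ 600000 * (X : ℝ) ^ 4 := by exact_mod_cast hbig
    have h2 := pow_le_pow_left₀ (Nat.cast_nonneg X) hXle 4
    rw [mul_pow] at h2
    linarith
  · intro h
    have h1 : (Gibb.updateTime s x : ℝ) ≤ 600000 * (X : ℝ) ^ 3 := by
      exact_mod_cast (hsmall (by simpa [Gibb.IsNormal, Gibb.IsIsolated] using h)).2
    have h2 := pow_le_pow_left₀ (Nat.cast_nonneg X) hXle 3
    rw [mul_pow] at h2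
    have h3 : (11 + K ^ 2 + K) ^ 3 ≤ (11 + K ^ 2 + K) ^ 4 :=
      pow_le_pow_right₀ (by nlinarith) (by norm_num)
    have h4 := mul_le_mul_of_nonneg_right h3 (show 0 ≤ Real.log C.V ^ 3 by positivity)
    linarith
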